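/- Let $G$ be a compact (Hausdorff topological) group. Write $\operatorname{Rep}G$ for the C$^*$-tensor category of finite-dimensional continuous unitary representations of $G$ (morphisms are all intertwining linear maps, the involution is the adjoint, the tensor product is the usual one), and $\mathrm{Hilb}$ for the C$^*$-tensor category of finite-dimensional Hilbert spaces. Choose representatives $U_j$, $j\in I$, of the isomorphism classes of irreducible unitary representations, and let $m_{jk}^i=\dim\operatorname{Hom}(U_i,U_j\otimes U_k)$. Let $\mathbb C[G]\subset C(G)$ be the $*$-algebra of matrix coefficients of finite-dimensional unitary representations, $\pi_h$ its representation on $L^2(G)$ (normalized Haar measure) by multiplication operators, which is the GNS-representation of the Haar state, $C_r(G)$ the norm closure of $\pi_h(\mathbb C[G])$, and $C_u(G)$ the universal enveloping C$^*$-algebra of $\mathbb C[G]$. Then $G$ is coamenable, that is, the following (mutually equivalent) conditions hold: (i) the fusion ring of $G$ with the classical dimension function is amenable: the operators $\Lambda_j\delta_k=\sum_i m_{jk}^i\delta_i$ extend to bounded operators on $\ell^2(I)$, and for every probability measure $\mu$ on $I$ the operator $\lambda_\mu=\sum_{j\in I}\frac{\mu(j)}{\dim U_j}\Lambda_j$ (a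 norm convergent sum) has $1$ in its spectrum; (ii) the counit $\varepsilon\colon\mathbb C[G]\to\mathbb C$, $\varepsilon(a)=a(e)$, extends to a character of $C_r(G)$, i.e. there is a unital $*$-homomorphism $\chi\colon C_r(G)\to\mathbb C$ with $\chi\circ\pi_h=\varepsilon$ on $\mathbb C[G]$; (iii) the canonical map $C_u(G)\to C_r(G)$ is an isomorphism, i.e. every unital $*$-homomorphism from $\mathbb C[G]$ to a unital C$^*$-algebra factors uniquely through $\pi_h\colon\mathbb C[G]\to C_r(G)$. Moreover, let $F\colon\operatorname{Rep}G\to\mathrm{Hilb}$ be a unitary fiber functor, that is, a $\mathbb C$-linear functor with $F(T^*)=F(T)^*$ for all morphisms $T$, together with natural unitaries $F(U)\otimes F(V)\to F(U\otimes V)$ and a unitary $\mathbb C\to F(\mathbf 1)$ satisfying the usual associativity and unit constraints. Then $\dim F(U)=\dim U$ for every object $U$ of $\operatorname{Rep}G$. -/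

import Mathlib

open CategoryTheory MonoidalCategory MeasureTheory
open scoped TensorProduct ENNReal

/-! ### The C*-tensor category of finite dimensional Hilbert spaces -/

/-- A finite dimensional complex Hilbert space. (Carriers live in `Type`; every finite dimensional
Hilbert space is isometric to `EuclideanSpace ℂ (Fin n)`, so nothing is lost.) -/
structure FdHilb where
  carrier : Type
  [instNormed : NormedAddCommGroup carrier]
  [instInner : InnerProductSpace ℂ carrier]
  [instFinite : FiniteDimensional ℂ carrier]

namespace FdHilb

instance : CoeSort FdHilb Type := ⟨carrier⟩

attribute [instance] instNormed instInner instFinite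

/-- Morphisms of finite dimensional Hilbert spaces: all linear maps. -/
@[ext]
structure Hom (H K : FdHilb) where
  hom : H →ₗ[ℂ] K

@[simps]
instance : Category FdHilb where
  Hom H K := Hom H K
  id H := ⟨LinearMap.id⟩
  comp f g := ⟨g.hom ∘ₗ f.hom⟩

@[ext]
theorem hom_ext {H K : FdHilb} {f g : H ⟶ K} (h : f.hom = g.hom) : f = g := Hom.ext h

/-- Morphisms are the same as linear maps. -/
def homEquiv (H K : FdHilb) : (H ⟶ K) ≃ (H →ₗ[ℂ] K) where
  toFun f := f.hom
  invFun f := ⟨f⟩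

instance (H K : FdHilb) : AddCommGroup (H ⟶ K) := (homEquiv H K).addCommGroup

instance (H K : FdHilb) : Module ℂ (H ⟶ K) := (homEquiv H K).module ℂ

@[simp] theorem add_hom {H K : FdHilb} (f g : H ⟶ K) : (f + g).hom = f.hom + g.hom := rfl

@[simp] theorem smul_hom {H K : FdHilb} (c : ℂ) (f : H ⟶ K) : (c • f).hom = c • f.hom := rfl

instance : Preadditive FdHilb where
  add_comp _ _ _ f f' g := by ext; simp
  comp_add _ _ _ f g g' := by ext; simp

instance : Linear ℂ FdHilb where
  smul_comp _ _ _ c f g := by ext; simp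
  comp_smul _ _ _ f c g := by ext; simp

/-- The adjoint (the involution of the C*-category). -/
noncomputable def dagger {H K : FdHilb} (f : H ⟶ K) : K ⟶ H := ⟨LinearMap.adjoint f.hom⟩

/-- A morphism `f` is unitary if `f* f = 1` and `f f* = 1`. -/
def IsUnitary {H K : FdHilb} (f : H ⟶ K) : Prop :=
  f ≫ dagger f = 𝟙 H ∧ dagger f ≫ f = 𝟙 K

/-- A linear isomorphism as an isomorphism in `FdHilb`. -/
@[simps]
def isoOfEquiv {H K : FdHilb} (e : H ≃ₗ[ℂ] K) : H ≅ K where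
  hom := ⟨e.toLinearMap⟩
  inv := ⟨e.symm.toLinearMap⟩
  hom_inv_id := by ext; simp
  inv_hom_id := by ext; simp

/-- The tensor product of Hilbert spaces, with unit object `ℂ`. -/
@[simps tensorObj tensorUnit whiskerLeft_hom whiskerRight_hom tensorHom_hom associator leftUnitor
  rightUnitor]
noncomputable instance : MonoidalCategoryStruct FdHilb where
  tensorObj H K := ⟨H ⊗[ℂ] K⟩
  whiskerLeft _ _ _ f := ⟨TensorProduct.map LinearMap.id f.hom⟩
  whiskerRight f _ := ⟨TensorProduct.map f.hom LinearMap.id⟩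
  tensorHom f g := ⟨TensorProduct.map f.hom g.hom⟩
  tensorUnit := ⟨ℂ⟩
  associator H K L := isoOfEquiv (TensorProduct.assoc ℂ H K L)
  leftUnitor H := isoOfEquiv (TensorProduct.lid ℂ H)
  rightUnitor H := isoOfEquiv (TensorProduct.rid ℂ H)

noncomputable instance : MonoidalCategory FdHilb where
  tensorHom_def f g := by
    ext : 1
    exact TensorProduct.ext' fun _ _ => rfl
  id_tensorHom_id H K := by
    ext : 1
    exact TensorProduct.ext' fun _ _ => rfl
  tensorHom_comp_tensorHom _ _ _ _ := by
    ext : 1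
    exact TensorProduct.ext' fun _ _ => rfl
  whiskerLeft_id _ _ := by
    ext : 1
    exact TensorProduct.ext' fun _ _ => rfl
  id_whiskerRight _ _ := by
    ext : 1
    exact TensorProduct.ext' fun _ _ => rfl
  associator_naturality _ _ _ := by
    ext : 1
    exact TensorProduct.ext_threefold fun _ _ _ => rfl
  leftUnitor_naturality f := by
    ext : 1
    exact TensorProduct.ext' fun c x => (f.hom.map_smul c x).symm
  rightUnitor_naturality f := by
    ext : 1
    exact TensorProduct.ext' fun x c => (f.hom.map_smul c x).symm
  pentagon _ _ _ _ := by
    ext : 1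
    exact TensorProduct.ext_fourfold fun _ _ _ _ => rfl
  triangle H K := by
    ext : 1
    exact TensorProduct.ext_threefold fun x (c : ℂ) y => (TensorProduct.smul_tmul c x y).symm

end FdHilb

/-! ### The C*-tensor category of finite dimensional unitary representations -/

universe u w

/-- A finite dimensional unitary representation of `G`: a homomorphism from `G` to the unitary
group of a finite dimensional Hilbert space, continuous in the strong (equivalently, norm)
operator topology. -/
structure UnitaryRep (G : Type u) [Group G] [TopologicalSpace G] where
  space : FdHilb
  ρ : G →* (space ≃ₗᵢ[ℂ] space)
  continuous_apply : ∀ v : space, Continuous fun g => ρ g v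

namespace UnitaryRep

variable {G : Type u} [Group G] [TopologicalSpace G]

/-- The underlying linear representation. -/
def rep (U : UnitaryRep G) : Representation ℂ G U.space where
  toFun g := (U.ρ g).toLinearEquiv.toLinearMap
  map_one' := by ext v; simp
  map_mul' g h := by ext v; simp

@[simp] theorem rep_apply (U : UnitaryRep G) (g : G) (v : U.space) : U.rep g v = U.ρ g v := rfl

/-- The classical dimension of a representation. -/
noncomputable def dim (U : UnitaryRep G) : ℕ := Module.finrank ℂ U.space

/-- Morphisms of unitary representations: all intertwining linear maps. -/
@[ext]
structure Hom (U V : UnitaryRep G) where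
  hom : Representation.IntertwiningMap U.rep V.rep

instance : Category (UnitaryRep G) where
  Hom U V := Hom U V
  id U := ⟨.id U.rep⟩
  comp f g := ⟨g.hom.comp f.hom⟩

@[ext]
theorem hom_ext {U V : UnitaryRep G} {f g : U ⟶ V}
    (h : f.hom.toLinearMap = g.hom.toLinearMap) : f = g :=
  Hom.ext (Representation.IntertwiningMap.ext h)

/-- Morphisms are the same as intertwining maps. -/
def homEquiv (U V : UnitaryRep G) : (U ⟶ V) ≃ Representation.IntertwiningMap U.rep V.rep where
  toFun f := f.hom
  invFun f := ⟨f⟩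

instance (U V : UnitaryRep G) : AddCommGroup (U ⟶ V) := (homEquiv U V).addCommGroup

instance (U V : UnitaryRep G) : Module ℂ (U ⟶ V) := (homEquiv U V).module ℂ

/-- The forgetful functor to Hilbert spaces. -/
def forget (G : Type u) [Group G] [TopologicalSpace G] : UnitaryRep G ⥤ FdHilb where
  obj U := U.space
  map f := ⟨f.hom.toLinearMap⟩

instance : (forget G).Faithful where
  map_injective h := hom_ext (congrArg FdHilb.Hom.hom h)

@[simp] theorem forget_map_add {U V : UnitaryRep G} (f g : U ⟶ V) :
    (forget G).map (f + g) = (forget G).map f + (forget G).map g := rfl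

@[simp] theorem forget_map_smul {U V : UnitaryRep G} (c : ℂ) (f : U ⟶ V) :
    (forget G).map (c • f) = c • (forget G).map f := rfl

instance : Preadditive (UnitaryRep G) where
  add_comp _ _ _ f f' g := (forget G).map_injective (by simp)
  comp_add _ _ _ f g g' := (forget G).map_injective (by simp)

instance : Linear ℂ (UnitaryRep G) where
  smul_comp _ _ _ c f g := (forget G).map_injective (by simp)
  comp_smul _ _ _ f c g := (forget G).map_injective (by simp)

/-- A linear map commuting with the group actions, as a morphism. -/
def mkHom {U V : UnitaryRep G} (f : U.space →ₗ[ℂ] V.space)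
    (h : ∀ g v, f (U.ρ g v) = V.ρ g (f v)) : U ⟶ V :=
  ⟨⟨f, fun g => LinearMap.ext fun v => h g v⟩⟩

theorem hom_comm {U V : UnitaryRep G} (f : U ⟶ V) (g : G) (v : U.space) :
    f.hom.toLinearMap (U.ρ g v) = V.ρ g (f.hom.toLinearMap v) :=
  f.hom.isIntertwining _ _ g v

theorem inner_ρ (U : UnitaryRep G) (g : G) (v w : U.space) :
    inner ℂ (U.ρ g v) w = inner ℂ v (U.ρ g⁻¹ w) := by
  rw [← LinearIsometryEquiv.inner_map_map (U.ρ g) v (U.ρ g⁻¹ w)]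
  congr 1
  have h : (U.ρ g * U.ρ g⁻¹) w = w := by rw [← map_mul, mul_inv_cancel, map_one]; rfl
  exact h.symm

/-- The adjoint of an intertwining map (the involution of the C*-category). -/
noncomputable def dagger {U V : UnitaryRep G} (f : U ⟶ V) : V ⟶ U :=
  mkHom (LinearMap.adjoint f.hom.toLinearMap) fun g v => by
    refine ext_inner_right ℂ fun x => ?_
    rw [LinearMap.adjoint_inner_left, inner_ρ, inner_ρ, LinearMap.adjoint_inner_left, hom_comm]

/-- The tensor product of representations, `g ↦ U(g) ⊗ V(g)`. -/
noncomputable def tensor (U V : UnitaryRep G) : UnitaryRep G where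
  space := U.space ⊗ V.space
  ρ :=
    { toFun := fun g => TensorProduct.congrIsometry (U.ρ g) (V.ρ g)
      map_one' := by
        apply LinearIsometryEquiv.toLinearEquiv_injective
        apply LinearEquiv.toLinearMap_injective
        exact TensorProduct.ext' fun a b => by simp
      map_mul' := fun g h => by
        apply LinearIsometryEquiv.toLinearEquiv_injective
        apply LinearEquiv.toLinearMap_injective
        exact TensorProduct.ext' fun a b => by simp }
  continuous_apply x := by
    induction x using TensorProduct.induction_on with
    | zero =>
      exact continuous_const.congr fun g =>
        (map_zero (TensorProduct.congrIsometry (U.ρ g) (V.ρ g))).symm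
    | tmul a b =>
      exact (TensorProduct.continuous_tmul (𝕜 := ℂ)).comp
        ((U.continuous_apply a).prodMk (V.continuous_apply b))
    | add a b ha hb =>
      exact (ha.add hb).congr fun g =>
        (map_add (TensorProduct.congrIsometry (U.ρ g) (V.ρ g)) a b).symm

/-- The trivial representation on `ℂ`. -/
noncomputable def trivial (G : Type u) [Group G] [TopologicalSpace G] : UnitaryRep G where
  space := 𝟙_ FdHilb
  ρ := 1
  continuous_apply v := by simpa using continuous_const

/-- An invertible linear map commuting with the group actions, as an isomorphism. -/
def mkIso {U V : UnitaryRep G} (e : U.space ≃ₗ[ℂ] V.space)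
    (h : ∀ g v, e (U.ρ g v) = V.ρ g (e v)) : U ≅ V where
  hom := mkHom e.toLinearMap h
  inv := mkHom e.symm.toLinearMap fun g v => by
    apply e.injective
    simp [h]
  hom_inv_id := hom_ext (LinearMap.ext fun v => e.symm_apply_apply v)
  inv_hom_id := hom_ext (LinearMap.ext fun v => e.apply_symm_apply v)

theorem tensor_ρ_tmul (U V : UnitaryRep G) (g : G) (a : U.space) (b : V.space) :
    (tensor U V).ρ g (a ⊗ₜ[ℂ] b) = U.ρ g a ⊗ₜ[ℂ] V.ρ g b := rfl

theorem map_tensor_comm {U U' V V' : UnitaryRep G} (f : U ⟶ U') (f' : V ⟶ V') (g : G)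
    (x : (tensor U V).space) :
    TensorProduct.map f.hom.toLinearMap f'.hom.toLinearMap ((tensor U V).ρ g x) =
      (tensor U' V').ρ g (TensorProduct.map f.hom.toLinearMap f'.hom.toLinearMap x) :=
  LinearMap.congr_fun
    (f := TensorProduct.map f.hom.toLinearMap f'.hom.toLinearMap ∘ₗ (tensor U V).rep g)
    (g := (tensor U' V').rep g ∘ₗ TensorProduct.map f.hom.toLinearMap f'.hom.toLinearMap)
    (TensorProduct.ext' fun a b =>
      congrArg₂ (fun a b => a ⊗ₜ[ℂ] b) (hom_comm f g a) (hom_comm f' g b)) x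

/-- The tensor product of intertwining maps. -/
noncomputable def tensorMap {U U' V V' : UnitaryRep G} (f : U ⟶ U') (f' : V ⟶ V') :
    tensor U V ⟶ tensor U' V' :=
  mkHom (TensorProduct.map f.hom.toLinearMap f'.hom.toLinearMap) (map_tensor_comm f f')

noncomputable instance : MonoidalCategoryStruct (UnitaryRep G) where
  tensorObj := tensor
  whiskerLeft U _ _ f := tensorMap (𝟙 U) f
  whiskerRight f V := tensorMap f (𝟙 V)
  tensorHom f f' := tensorMap f f'
  tensorUnit := trivial G
  associator U V W := mkIso (TensorProduct.assoc ℂ U.space V.space W.space) fun g x =>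
    LinearMap.congr_fun
      (f := (TensorProduct.assoc ℂ U.space V.space W.space).toLinearMap ∘ₗ
        (tensor (tensor U V) W).rep g)
      (g := (tensor U (tensor V W)).rep g ∘ₗ
        (TensorProduct.assoc ℂ U.space V.space W.space).toLinearMap)
      (TensorProduct.ext_threefold fun _ _ _ => rfl) x
  leftUnitor U := mkIso (TensorProduct.lid ℂ U.space) fun g x =>
    LinearMap.congr_fun
      (f := (TensorProduct.lid ℂ U.space).toLinearMap ∘ₗ (tensor (trivial G) U).rep g)
      (g := U.rep g ∘ₗ (TensorProduct.lid ℂ U.space).toLinearMap)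
      (TensorProduct.ext' fun (c : ℂ) v => (map_smul (U.ρ g) c v).symm) x
  rightUnitor U := mkIso (TensorProduct.rid ℂ U.space) fun g x =>
    LinearMap.congr_fun
      (f := (TensorProduct.rid ℂ U.space).toLinearMap ∘ₗ (tensor U (trivial G)).rep g)
      (g := U.rep g ∘ₗ (TensorProduct.rid ℂ U.space).toLinearMap)
      (TensorProduct.ext' fun v (c : ℂ) => (map_smul (U.ρ g) c v).symm) x

/-- The forgetful functor carries the tensor operations on representations to those on Hilbert
spaces, on the nose. -/
noncomputable def forgetData : Monoidal.InducingFunctorData (forget G) where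
  μIso _ _ := Iso.refl _
  εIso := Iso.refl _
  whiskerLeft_eq _ _ _ _ := by
    simp only [Iso.refl_inv, Iso.refl_hom]
    exact ((Category.id_comp _).trans (Category.comp_id _)).symm
  whiskerRight_eq _ _ := by
    simp only [Iso.refl_inv, Iso.refl_hom]
    exact ((Category.id_comp _).trans (Category.comp_id _)).symm
  tensorHom_eq _ _ := by
    simp only [Iso.refl_inv, Iso.refl_hom]
    exact ((Category.id_comp _).trans (Category.comp_id _)).symm
  associator_eq U V W := by
    apply FdHilb.hom_ext
    exact TensorProduct.ext_threefold fun _ _ _ => rfl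
  leftUnitor_eq U := by
    apply FdHilb.hom_ext
    exact TensorProduct.ext' fun _ _ => rfl
  rightUnitor_eq U := by
    apply FdHilb.hom_ext
    exact TensorProduct.ext' fun _ _ => rfl

noncomputable instance : MonoidalCategory (UnitaryRep G) := Monoidal.induced (forget G) forgetData

end UnitaryRep

/-- A unitary fiber functor on `Rep G`: a `ℂ`-linear, adjoint preserving functor `F` to finite
dimensional Hilbert spaces together with natural unitaries
`F₂(U, V) : F(U) ⊗ F(V) → F(U ⊗ V)` and a unitary `F₀ : ℂ → F(1)` satisfying the usual
associativity and unit constraints (the field `monoidal`). -/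
structure UnitaryFiberFunctor (G : Type u) [Group G] [TopologicalSpace G] where
  toFunctor : UnitaryRep G ⥤ FdHilb
  additive : toFunctor.Additive
  linear : toFunctor.Linear ℂ
  monoidal : toFunctor.Monoidal
  map_dagger : ∀ {U V : UnitaryRep G} (f : U ⟶ V),
    toFunctor.map (UnitaryRep.dagger f) = FdHilb.dagger (toFunctor.map f)
  unitary_μ : ∀ U V : UnitaryRep G,
    FdHilb.IsUnitary (Functor.LaxMonoidal.μ toFunctor U V)
  unitary_ε : FdHilb.IsUnitary (Functor.LaxMonoidal.ε toFunctor)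

/-! ### Amenability of fusion rings -/

/-- Let `⊕_{j ∈ I} ℤ j` be a fusion ring with structure constants `j k = ∑ᵢ m j k i • i` and let
`d` be a dimension function on it. The pair is amenable if the operators `Λ j` of multiplication
by `j` on the left extend to bounded operators on `ℓ²(I)` and, for every probability measure `μ`
on `I`, the operator `λ_μ = ∑ⱼ (μ j / d j) Λ j` has `1` in its spectrum. -/
def FusionAmenable {I : Type w} (m : I → I → I → ℕ) (d : I → ℝ) : Prop :=
  open scoped Classical in
  ∃ Λ : I → (lp (fun _ : I => ℂ) 2 →L[ℂ] lp (fun _ : I => ℂ) 2),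
    (∀ j k i, Λ j (lp.single 2 k 1) i = m j k i) ∧
    ∀ μ : I → ℝ, (∀ j, 0 ≤ μ j) → HasSum μ 1 →
      ∃ T : lp (fun _ : I => ℂ) 2 →L[ℂ] lp (fun _ : I => ℂ) 2,
        HasSum (fun j => ((μ j / d j : ℝ) : ℂ) • Λ j) T ∧ (1 : ℂ) ∈ spectrum ℂ T

/-- The set of isomorphism classes of irreducible unitary representations of `G`. -/
def Irr (G : Type u) [Group G] [TopologicalSpace G] : Type (max 1 u) :=
  Quotient ((isIsomorphicSetoid (UnitaryRep G)).comap
    (Subtype.val : {U : UnitaryRep G // U.rep.IsIrreducible} → UnitaryRep G))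

namespace Irr

variable {G : Type u} [Group G] [TopologicalSpace G]

/-- A representative of an isomorphism class of irreducible representations. -/
noncomputable def out (j : Irr G) : UnitaryRep G := (Quotient.out j).1

/-- `fusion j k i` is the multiplicity of `i` in `j ⊗ k`. -/
noncomputable def fusion (j k i : Irr G) : ℕ := Module.finrank ℂ (i.out ⟶ j.out ⊗ k.out)

/-- The classical dimension function. -/
noncomputable def dim (j : Irr G) : ℝ := j.out.dim

end Irr

/-! ### The function algebra, the Haar state and the reduced C*-algebra -/

section algebras

variable (G : Type u) [Group G] [TopologicalSpace G]

/-- The matrix coefficients of finite dimensional unitary representations. -/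
def matrixCoefficients : Set C(G, ℂ) :=
  {f | ∃ (U : UnitaryRep G) (v w : U.space), ∀ g, f g = inner ℂ v (U.ρ g w)}

/-- The algebra `ℂ[G]` of regular functions on `G`, as a `*`-subalgebra of `C(G)`: it is generated
(in fact, spanned) by the matrix coefficients of finite dimensional unitary representations. -/
noncomputable def regularFunctions : StarSubalgebra ℂ C(G, ℂ) := StarAlgebra.adjoin ℂ (matrixCoefficients G)

variable [IsTopologicalGroup G] [CompactSpace G] [MeasurableSpace G] [BorelSpace G]

/-- The normalized Haar measure. -/
noncomputable def haarProb : Measure G := Measure.haarMeasure ⊤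

instance : IsProbabilityMeasure (haarProb G) :=
  ⟨Measure.haarMeasure_self (K₀ := (⊤ : TopologicalSpace.PositiveCompacts G))⟩

/-- The space `L²(G)`. -/
abbrev L2 : Type u := Lp ℂ 2 (haarProb G)

/-- Multiplication by a continuous function, as a bounded operator on `L²(G)`. -/
noncomputable def mulOp (f : C(G, ℂ)) : L2 G →L[ℂ] L2 G :=
  (ContinuousLinearMap.mul ℂ ℂ).holderL (haarProb G) ∞ 2 2 (ContinuousMap.toLp ∞ (haarProb G) ℂ f)

theorem mulOp_apply (f : C(G, ℂ)) (ξ : L2 G) :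
    mulOp G f ξ =ᵐ[haarProb G] fun x => f x * ξ x := by
  have h := (ContinuousLinearMap.mul ℂ ℂ).coeFn_holder (r := 2)
    (ContinuousMap.toLp ∞ (haarProb G) ℂ f) ξ
  filter_upwards [h, ContinuousMap.coeFn_toLp (p := ∞) (𝕜 := ℂ) (haarProb G) f] with x hx hf
  rw [← hf]
  exact hx

/-- The GNS representation of the Haar state: `f ∈ C(G)` acts on `L²(G)` by multiplication. -/
noncomputable def mulRep : C(G, ℂ) →⋆ₐ[ℂ] (L2 G →L[ℂ] L2 G) where
  toFun := mulOp G
  map_one' := by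
    ext1 ξ
    apply Lp.ext
    filter_upwards [mulOp_apply G 1 ξ] with x hx
    simpa using hx
  map_mul' f g := by
    ext1 ξ
    apply Lp.ext
    filter_upwards [mulOp_apply G (f * g) ξ, mulOp_apply G f (mulOp G g ξ), mulOp_apply G g ξ]
      with x h1 h2 h3
    rw [mul_apply_eq_comp, h1, h2, h3, ContinuousMap.mul_apply, mul_assoc]
  map_zero' := by simp [mulOp]
  map_add' f g := by simp [mulOp]
  commutes' c := by
    ext1 ξ
    apply Lp.ext
    filter_upwards [mulOp_apply G (algebraMap ℂ C(G, ℂ) c) ξ, Lp.coeFn_smul c ξ] with x h1 h2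
    rw [h1, Algebra.algebraMap_eq_smul_one (A := L2 G →L[ℂ] L2 G)]
    simp [h2]
  map_star' f := by
    rw [ContinuousLinearMap.star_eq_adjoint, ContinuousLinearMap.eq_adjoint_iff]
    intro ξ η
    rw [L2.inner_def, L2.inner_def]
    apply integral_congr_ae
    filter_upwards [mulOp_apply G (star f) ξ, mulOp_apply G f η] with x h1 h2
    rw [h1, h2]
    simp only [RCLike.inner_apply, ContinuousMap.star_apply, map_mul]
    simp
    ring

/-- The reduced C*-algebra `C_r(G)`: the norm closure of the image of `ℂ[G]` in the GNS
representation of the Haar state. -/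
noncomputable def reducedAlgebra : StarSubalgebra ℂ (L2 G →L[ℂ] L2 G) :=
  ((regularFunctions G).map (mulRep G)).topologicalClosure

instance : IsClosed (reducedAlgebra G : Set (L2 G →L[ℂ] L2 G)) :=
  StarSubalgebra.isClosed_topologicalClosure _

/-- The canonical map `π_h : ℂ[G] → C_r(G)`. -/
noncomputable def reducedRep : regularFunctions G →⋆ₐ[ℂ] reducedAlgebra G :=
  ((mulRep G).comp (regularFunctions G).subtype).codRestrict (reducedAlgebra G) fun a =>
    StarSubalgebra.le_topologicalClosure _ (StarSubalgebra.mem_map.2 ⟨a, a.2, rfl⟩)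

end algebras

/-- The pair `(C, ι)` is the universal enveloping C*-algebra of the unital `*`-algebra `A`: every
unital `*`-homomorphism from `A` to a unital C*-algebra factors uniquely through `ι`. -/
def IsEnvelopingCStarAlgebra {A : Type u} [Ring A] [StarRing A] [Algebra ℂ A]
    {C : Type u} [CStarAlgebra C] (ι : A →⋆ₐ[ℂ] C) : Prop :=
  ∀ (B : Type w) [CStarAlgebra B] (φ : A →⋆ₐ[ℂ] B), ∃! ψ : C →⋆ₐ[ℂ] B, ψ.comp ι = φ

/-- Coamenability of a compact group, regarded as a compact quantum group. The three conditions
are well known to be equivalent to each other for every compact quantum group, and each of them is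
in use as the definition of coamenability. -/
structure IsCoamenable (G : Type u) [Group G] [TopologicalSpace G] [IsTopologicalGroup G]
    [CompactSpace G] [MeasurableSpace G] [BorelSpace G] : Prop where
  /-- The fusion ring of `G` with the classical dimension function is amenable. -/
  fusion : FusionAmenable (Irr.fusion (G := G)) Irr.dim
  /-- The counit `a ↦ a(e)` of `ℂ[G]` extends to a character of `C_r(G)`. -/
  counit : ∃ χ : reducedAlgebra G →⋆ₐ[ℂ] ℂ,
    ∀ a : regularFunctions G, χ (reducedRep G a) = (a : C(G, ℂ)) 1
  /-- The canonical map `C_u(G) → C_r(G)` is an isomorphism, that is, `C_r(G)` with the map `π_h`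
  is a universal enveloping C*-algebra of `ℂ[G]`. -/
  universal : IsEnvelopingCStarAlgebra.{u, w} (reducedRep G)

/-! Everything rests on one principle, `le_of_integral_pow_le`. If `f ≥ 0` is continuous and `∫ f^n
≤ K s^n` for all `n`, then `f ≤ s` everywhere, because Haar measure charges every nonempty open set.
In particular `f(e) ≤ s`: growth of moments controls values at the identity. It is used three times.

Universality. Let `θ` be a character of `ℂ[G]` and let `R_x` be right translation. By invariance of
Haar measure, `x ↦ |θ(R_x a)|²` has the same moments as `|a|²`, so at `x = e` one gets `|θ(a)| ≤
‖π_h(a)‖` (`norm_character_le`). As `ℂ[G]` is commutative, Gelfand theory extends this bound to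
every representation in a C*-algebra. Hence each of them extends to `C_r(G)`, and the counit is the
case of target `ℂ`.

Fusion ring. The irreducible characters are orthonormal, so `ℓ²(Irr G)` embeds in `L²(G)`. There
`Λ_j` is the compression of multiplication by `χ_j`, and `λ_μ` that of multiplication by `f = ∑ (μ_j
/ d_j) χ_j`, with `‖f‖ ≤ 1` and `f(e) = 1`. If `1 - λ_μ` were invertible, the moments of `|(1 +
f)/2|²` would decay geometrically, although this function is `1` at `e`
(`one_mem_spectrum_charCompression`).

Fiber functors. `F` preserves the conjugate equations and the norms of their solutions, which gives
`dim F(U) ≤ dim U` (`finrank_obj_le`). Conversely `F` is faithful, so `∫ |χ_U|^(2n) = dim End(U^⊗n)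
≤ dim F(U)^(2n)`, and the principle at `e` gives `dim U ≤ dim F(U)` (`le_finrank_obj`). -/

/-! ### Moments with respect to Haar measure. -/

section haar

variable {G : Type u} [Group G] [TopologicalSpace G] [IsTopologicalGroup G] [CompactSpace G]
  [MeasurableSpace G] [BorelSpace G]

instance : (haarProb G).IsHaarMeasure := by
  unfold haarProb; infer_instance

theorem integrable_haarProb {E : Type*} [NormedAddCommGroup E] {f : G → E} (hf : Continuous f) :
    Integrable f (haarProb G) :=
  hf.integrable_of_hasCompactSupport (HasCompactSupport.of_compactSpace f)

/-- The growth of the moments of a nonnegative continuous function on a compact group bounds the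
values of this function. -/
theorem le_of_integral_pow_le {f : G → ℝ} (hf : Continuous f) (h0 : ∀ x, 0 ≤ f x) {K s : ℝ}
    (hs : 0 ≤ s) (h : ∀ n : ℕ, ∫ x, f x ^ n ∂haarProb G ≤ K * s ^ n) (x : G) : f x ≤ s := by
  by_contra! hx
  obtain ⟨r, hsr, hrx⟩ := exists_between hx
  have hr : 0 < r := hs.trans_lt hsr
  have hU : IsOpen {y | r < f y} := isOpen_lt continuous_const hf
  have hc : 0 < (haarProb G).real {y | r < f y} :=
    ENNReal.toReal_pos (hU.measure_pos _ ⟨x, hrx⟩).ne' (measure_ne_top _ _)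
  -- Chebyshev's inequality for `f ^ n`. Since `s / r < 1`, letting `n → ∞` forces the open set `{f
  -- > r}` to be null, but it contains `x`.
  have key : ∀ n : ℕ, (haarProb G).real {y | r < f y} ≤ K * (s / r) ^ n := by
    intro n
    have hi := integrable_haarProb (hf.pow n)
    have h1 : (haarProb G).real {y | r < f y} * r ^ n ≤ ∫ y, f y ^ n ∂haarProb G := by
      calc _ ≤ ∫ y in {y | r < f y}, f y ^ n ∂haarProb G := by
            rw [mul_comm]
            refine setIntegral_ge_of_const_le_real hU.measurableSet (measure_ne_top _ _)
              (fun y hy => ?_) hi.integrableOn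
            exact pow_le_pow_left₀ hr.le (le_of_lt hy) n
        _ ≤ _ := setIntegral_le_integral hi (.of_forall fun y => pow_nonneg (h0 y) n)
    rw [div_pow, ← mul_div_assoc, le_div_iff₀ (pow_pos hr n)]
    exact h1.trans (h n)
  have hlim : Filter.Tendsto (fun n : ℕ => K * (s / r) ^ n) Filter.atTop (nhds (K * 0)) :=
    (tendsto_pow_atTop_nhds_zero_of_lt_one (by positivity) ((div_lt_one hr).2 hsr)).const_mul K
  rw [mul_zero] at hlim
  exact hc.not_ge (ge_of_tendsto' hlim key)

theorem norm_toLp_sq (f : C(G, ℂ)) :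
    ‖ContinuousMap.toLp 2 (haarProb G) ℂ f‖ ^ 2 = ∫ x, ‖f x‖ ^ 2 ∂haarProb G := by
  have h := L2.inner_def (𝕜 := ℂ) (ContinuousMap.toLp 2 (haarProb G) ℂ f)
    (ContinuousMap.toLp 2 (haarProb G) ℂ f)
  rw [inner_self_eq_norm_sq_to_K] at h
  have h2 : ∫ x, inner ℂ (ContinuousMap.toLp 2 (haarProb G) ℂ f x)
      (ContinuousMap.toLp 2 (haarProb G) ℂ f x) ∂haarProb G =
      ∫ x, ((‖f x‖ ^ 2 : ℝ) : ℂ) ∂haarProb G := by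
    apply integral_congr_ae
    filter_upwards [ContinuousMap.coeFn_toLp (p := 2) (𝕜 := ℂ) (haarProb G) f] with x hx
    rw [hx, inner_self_eq_norm_sq_to_K]
    simp
  rw [h2] at h
  refine Complex.ofReal_injective ?_
  rw [← integral_complex_ofReal, ← h]
  simp

theorem mulOp_toLp (f g : C(G, ℂ)) :
    mulOp G f (ContinuousMap.toLp 2 (haarProb G) ℂ g) =
      ContinuousMap.toLp 2 (haarProb G) ℂ (f * g) := by
  apply Lp.ext
  filter_upwards [mulOp_apply G f (ContinuousMap.toLp 2 (haarProb G) ℂ g),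
    ContinuousMap.coeFn_toLp (p := 2) (𝕜 := ℂ) (haarProb G) g,
    ContinuousMap.coeFn_toLp (p := 2) (𝕜 := ℂ) (haarProb G) (f * g)] with x h1 h2 h3
  rw [h1, h2, h3, ContinuousMap.mul_apply]

/-- The moments of a continuous function are bounded by the norm of the multiplication operator. -/
theorem integral_norm_sq_pow_le (f : C(G, ℂ)) (n : ℕ) :
    ∫ x, (‖f x‖ ^ 2) ^ n ∂haarProb G ≤ 1 * (‖mulRep G f‖ ^ 2) ^ n := by
  -- The constant function `1` is the cyclic unit vector, and the powers of the operator move it to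
  -- the powers of `f`.
  have h1 : ∀ m : ℕ, (mulRep G f ^ m) (ContinuousMap.toLp 2 (haarProb G) ℂ 1) =
      ContinuousMap.toLp 2 (haarProb G) ℂ (f ^ m) := by
    intro m
    rw [← map_pow]
    exact (mulOp_toLp (f ^ m) 1).trans (by rw [mul_one])
  have h2 : ‖ContinuousMap.toLp 2 (haarProb G) ℂ (1 : C(G, ℂ))‖ ^ 2 = 1 := by
    rw [norm_toLp_sq]; simp
  have h3 : ‖ContinuousMap.toLp 2 (haarProb G) ℂ (1 : C(G, ℂ))‖ = 1 :=
    (pow_eq_one_iff_of_nonneg (norm_nonneg _) two_ne_zero).1 h2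
  calc ∫ x, (‖f x‖ ^ 2) ^ n ∂haarProb G
      = ∫ x, ‖(f ^ n) x‖ ^ 2 ∂haarProb G := by
        simp only [ContinuousMap.pow_apply, norm_pow, ← pow_mul, mul_comm]
    _ = ‖(mulRep G f ^ n) (ContinuousMap.toLp 2 (haarProb G) ℂ 1)‖ ^ 2 := by
        rw [h1, norm_toLp_sq]
    _ ≤ (‖mulRep G f‖ ^ n) ^ 2 := by
        refine pow_le_pow_left₀ (norm_nonneg _) ?_ 2
        refine (ContinuousLinearMap.le_opNorm _ _).trans ?_
        rw [h3, mul_one]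
        rcases n.eq_zero_or_pos with rfl | hn
        · simpa using! ContinuousLinearMap.norm_id_le (𝕜 := ℂ) (E := L2 G)
        · exact norm_pow_le' _ hn
    _ = _ := by rw [one_mul, ← pow_mul, ← pow_mul, mul_comm]

end haar

/-! ### Universality of the reduced C*-algebra. -/

section envelope

variable {G : Type u} [Group G] [TopologicalSpace G]

theorem regularFunctions_induction {p : regularFunctions G → Prop}
    (mem : ∀ f (hf : f ∈ regularFunctions G), f ∈ matrixCoefficients G → p ⟨f, hf⟩)
    (algebraMap : ∀ r, p (algebraMap ℂ (regularFunctions G) r))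
    (add : ∀ a b, p a → p b → p (a + b)) (mul : ∀ a b, p a → p b → p (a * b))
    (star : ∀ a, p a → p (star a)) (a : regularFunctions G) : p a :=
  StarAlgebra.adjoin_induction_subtype a (fun f hf => mem f _ hf) algebraMap add mul star

variable [IsTopologicalGroup G]

/-- Right translation of continuous functions. -/
noncomputable def rightTranslate (x : G) : C(G, ℂ) →⋆ₐ[ℂ] C(G, ℂ) where
  toFun f := f.comp ⟨fun g => g * x, continuous_mul_const x⟩
  map_one' := rfl
  map_mul' _ _ := rfl
  map_zero' := rfl
  map_add' _ _ := rfl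
  commutes' _ := rfl
  map_star' _ := rfl

theorem rightTranslate_mem (x : G) {f : C(G, ℂ)} (hf : f ∈ regularFunctions G) :
    rightTranslate x f ∈ regularFunctions G := by
  suffices regularFunctions G ≤ (regularFunctions G).comap (rightTranslate x) from this hf
  refine StarAlgebra.adjoin_le ?_
  rintro f ⟨U, v, w, h⟩
  refine StarAlgebra.subset_adjoin ℂ _ ⟨U, v, U.ρ x w, fun g => (h (g * x)).trans ?_⟩
  rw [map_mul]; rfl

/-- Right translation of regular functions. -/
noncomputable def regularTranslate (x : G) : regularFunctions G →⋆ₐ[ℂ] regularFunctions G :=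
  ((rightTranslate x).comp (regularFunctions G).subtype).codRestrict (regularFunctions G)
    fun a => rightTranslate_mem x a.2

theorem regularTranslate_apply (x : G) (a : regularFunctions G) (g : G) :
    (regularTranslate x a : C(G, ℂ)) g = (a : C(G, ℂ)) (g * x) := rfl

theorem regularTranslate_one (a : regularFunctions G) : regularTranslate 1 a = a := by
  apply Subtype.ext
  ext g
  rw [regularTranslate_apply, mul_one]

/-- The translates of a regular function span a finite dimensional space. -/
theorem exists_regularTranslate_eq_sum (a : regularFunctions G) :
    ∃ (ι : Type) (_ : Fintype ι) (b : ι → C(G, ℂ)) (c : ι → regularFunctions G),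
      ∀ x, regularTranslate x a = ∑ i, b i x • c i := by
  induction a using regularFunctions_induction with
  | mem f hf hm =>
    obtain ⟨U, v, w, h⟩ := hm
    let e := stdOrthonormalBasis ℂ U.space
    refine ⟨_, inferInstance,
      fun i => ⟨fun x => inner ℂ (e i) (U.ρ x w), continuous_const.inner (U.continuous_apply w)⟩,
      fun i => ⟨⟨fun g => inner ℂ v (U.ρ g (e i)),
        continuous_const.inner (U.continuous_apply (e i))⟩,
        StarAlgebra.subset_adjoin ℂ _ ⟨U, v, e i, fun g => rfl⟩⟩, fun x => Subtype.ext ?_⟩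
    ext g
    rw [regularTranslate_apply, AddSubmonoidClass.coe_finsetSum, ContinuousMap.sum_apply]
    refine (h (g * x)).trans ?_
    -- Expanding `U(x) w` in the basis `e` is the coproduct of a matrix coefficient: it separates
    -- the variables `g` and `x`.
    have h1 : U.ρ (g * x) w = U.ρ g (∑ i, inner ℂ (e i) (U.ρ x w) • e i) := by
      rw [e.sum_repr', map_mul]; rfl
    rw [h1, map_sum, inner_sum]
    refine Finset.sum_congr rfl fun i _ => ?_
    rw [map_smul, inner_smul_right]
    rfl
  | algebraMap r =>
    refine ⟨Unit, inferInstance, fun _ => 1, fun _ => algebraMap ℂ _ r, fun x => ?_⟩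
    rw [AlgHomClass.commutes]
    simp
  | add a₁ a₂ h₁ h₂ =>
    obtain ⟨ι, _, b, c, h⟩ := h₁
    obtain ⟨κ, _, b', c', h'⟩ := h₂
    refine ⟨ι ⊕ κ, inferInstance, Sum.elim b b', Sum.elim c c', fun x => ?_⟩
    rw [map_add, h, h', Fintype.sum_sum_type]
    rfl
  | mul a₁ a₂ h₁ h₂ =>
    obtain ⟨ι, _, b, c, h⟩ := h₁
    obtain ⟨κ, _, b', c', h'⟩ := h₂
    refine ⟨ι × κ, inferInstance, fun i => b i.1 * b' i.2, fun i => c i.1 * c' i.2, fun x => ?_⟩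
    rw [map_mul, h, h', Finset.sum_mul_sum, Fintype.sum_prod_type]
    simp only [ContinuousMap.mul_apply, smul_mul_smul_comm]
  | star a h₁ =>
    obtain ⟨ι, _, b, c, h⟩ := h₁
    refine ⟨ι, inferInstance, fun i => star (b i), fun i => star (c i), fun x => ?_⟩
    rw [map_star, h, star_sum]
    simp only [star_smul, ContinuousMap.star_apply]

variable [CompactSpace G] [MeasurableSpace G] [BorelSpace G]

/-- Translating by a linear functional on `ℂ[G]` preserves the Haar integral, up to the value of
the functional at `1`. -/
theorem integral_regularTranslate (θ : regularFunctions G →ₗ[ℂ] ℂ) (a : regularFunctions G) :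
    Continuous (fun x => θ (regularTranslate x a)) ∧
      ∫ x, θ (regularTranslate x a) ∂haarProb G =
        (∫ x, (a : C(G, ℂ)) x ∂haarProb G) * θ 1 := by
  obtain ⟨ι, _, b, c, h⟩ := exists_regularTranslate_eq_sum a
  have h1 : ∀ x, θ (regularTranslate x a) = ∑ i, b i x * θ (c i) := fun x => by simp [h]
  have hc : ∀ z : ℂ, ∀ i, Integrable (fun x => b i x * z) (haarProb G) := fun z i =>
    integrable_haarProb ((b i).continuous.mul continuous_const)
  -- Left invariance, read at each point `g`. Because the sum is finite, `θ` can afterwards be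
  -- applied to this identity with no continuity assumption on `θ`.
  have h2 : ∑ i, (∫ x, b i x ∂haarProb G) • c i =
      (∫ x, (a : C(G, ℂ)) x ∂haarProb G) • (1 : regularFunctions G) := by
    apply Subtype.ext
    ext g
    calc _ = ∑ i, (∫ x, b i x ∂haarProb G) * (c i : C(G, ℂ)) g := by
          rw [AddSubmonoidClass.coe_finsetSum, ContinuousMap.sum_apply]; rfl
      _ = ∫ x, ∑ i, b i x * (c i : C(G, ℂ)) g ∂haarProb G := by
          rw [integral_finsetSum _ fun i _ => hc _ i]
          simp only [integral_mul_const]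
      _ = ∫ x, (a : C(G, ℂ)) (g * x) ∂haarProb G := by
          refine integral_congr_ae (.of_forall fun x => ?_)
          simp only
          rw [← regularTranslate_apply, h, AddSubmonoidClass.coe_finsetSum,
            ContinuousMap.sum_apply]
          rfl
      _ = ∫ x, (a : C(G, ℂ)) x ∂haarProb G := integral_mul_left_eq_self (fun x => (a : C(G, ℂ)) x) g
      _ = _ := by simp
  refine ⟨?_, ?_⟩
  · simp only [h1]
    fun_prop
  · simp only [h1]
    rw [integral_finsetSum _ fun i _ => hc _ i]
    simp only [integral_mul_const]
    have := congrArg θ h2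
    simpa using this

/-- Characters of `ℂ[G]` are bounded with respect to the norm of `C_r(G)`. -/
theorem norm_character_le (θ : regularFunctions G →⋆ₐ[ℂ] ℂ) (a : regularFunctions G) :
    ‖θ a‖ ≤ ‖reducedRep G a‖ := by
  have hI := integral_regularTranslate θ.toLinearMap
  have hc : Continuous fun x => ‖θ (regularTranslate x a)‖ ^ 2 := ((hI a).1.norm).pow 2
  have hn : ∀ n : ℕ, ∫ x, (‖θ (regularTranslate x a)‖ ^ 2) ^ n ∂haarProb G =
      ∫ x, (‖(a : C(G, ℂ)) x‖ ^ 2) ^ n ∂haarProb G := by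
    intro n
    -- Translation and `θ` are both `*`-homomorphisms, so `θ` of the translate of `(a* a)^n` is
    -- `|θ(R_x a)|^(2n)`.
    have h := (hI ((star a * a) ^ n)).2
    have h1 : θ.toLinearMap 1 = 1 := map_one θ
    rw [h1, mul_one] at h
    apply Complex.ofReal_injective
    rw [← integral_complex_ofReal, ← integral_complex_ofReal]
    refine Eq.trans ?_ (h.trans ?_)
    · refine integral_congr_ae (.of_forall fun x => ?_)
      change _ = θ _
      simp [map_mul, map_star, ← Complex.conj_mul']
    · refine integral_congr_ae (.of_forall fun x => ?_)
      simp [← Complex.conj_mul']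
  have key := le_of_integral_pow_le hc (fun x => by positivity)
    (s := ‖mulRep G (a : C(G, ℂ))‖ ^ 2) (K := 1) (by positivity)
    (fun n => (hn n).trans_le (integral_norm_sq_pow_le _ n)) 1
  rw [regularTranslate_one] at key
  exact (pow_le_pow_iff_left₀ (norm_nonneg _) (norm_nonneg _) two_ne_zero).1 key

/-- Representations of `ℂ[G]` in C*-algebras are bounded with respect to the norm of `C_r(G)`. -/
theorem norm_starAlgHom_le {B : Type w} [CStarAlgebra B] (φ : regularFunctions G →⋆ₐ[ℂ] B)
    (a : regularFunctions G) : ‖φ a‖ ≤ ‖reducedRep G a‖ := by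
  let S := φ.range
  have hS : ∀ x y : S, x * y = y * x := by
    rintro ⟨_, x, rfl⟩ ⟨_, y, rfl⟩
    apply Subtype.ext
    change φ x * φ y = φ y * φ x
    rw [← map_mul, ← map_mul, mul_comm]
  have : IsClosed (S.topologicalClosure : Set B) := S.isClosed_topologicalClosure
  let _ : CommCStarAlgebra S.topologicalClosure :=
    { (inferInstance : CStarAlgebra S.topologicalClosure) with
      mul_comm := (S.commRingTopologicalClosure hS).mul_comm }
  let φ' : regularFunctions G →⋆ₐ[ℂ] S.topologicalClosure :=
    φ.codRestrict _ fun x => S.le_topologicalClosure ⟨x, rfl⟩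
  -- The closure of the image is a commutative C*-algebra, so its norm is the supremum over its
  -- characters. Each of these pulls back along `φ'` to a character of `ℂ[G]`.
  have h1 : ‖φ a‖ = ‖WeakDual.gelfandTransform ℂ S.topologicalClosure (φ' a)‖ :=
    (((AddMonoidHomClass.isometry_iff_norm _).1
      (gelfandTransform_isometry S.topologicalClosure)) (φ' a)).symm
  rw [h1, ContinuousMap.norm_le _ (norm_nonneg _)]
  intro ω
  exact norm_character_le
    ({ (WeakDual.CharacterSpace.toAlgHom ω).comp φ'.toAlgHom with
      map_star' := fun x => by
        change ω (φ' (star x)) = star (ω (φ' x))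
        rw [map_star, map_star] } : regularFunctions G →⋆ₐ[ℂ] ℂ) a

theorem denseRange_reducedRep : DenseRange (reducedRep G) := by
  intro x
  rw [closure_subtype]
  have h : Subtype.val '' Set.range (reducedRep G) =
      ((regularFunctions G).map (mulRep G) : Set (L2 G →L[ℂ] L2 G)) := by
    ext y
    constructor
    · rintro ⟨_, ⟨a, rfl⟩, rfl⟩
      exact ⟨a, a.2, rfl⟩
    · rintro ⟨a, ha, rfl⟩
      exact ⟨_, ⟨⟨a, ha⟩, rfl⟩, rfl⟩
  rw [h]
  exact x.2

open scoped CStarAlgebra in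
/-- The reduced C*-algebra of a compact group is universal. -/
theorem isEnvelopingCStarAlgebra_reducedRep :
    IsEnvelopingCStarAlgebra.{u, w} (reducedRep G) := by
  intro B _ φ
  have hd : DenseRange (reducedRep G).toLinearMap := denseRange_reducedRep
  have hb : ∀ a, ‖φ.toLinearMap a‖ ≤ 1 * ‖(reducedRep G).toLinearMap a‖ := fun a => by
    rw [one_mul]; exact norm_starAlgHom_le φ a
  let ψ : reducedAlgebra G →L[ℂ] B := φ.toLinearMap.extendOfNorm (reducedRep G).toLinearMap
  have hψ : ∀ a, ψ (reducedRep G a) = φ a := fun a => LinearMap.extendOfNorm_eq hd ⟨1, hb⟩ a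
  have hdr := denseRange_reducedRep (G := G)
  refine ⟨{ ψ with
    map_one' := ?_, map_mul' := ?_, map_zero' := map_zero ψ, commutes' := ?_, map_star' := ?_ },
    ?_, ?_⟩
  · change ψ 1 = 1
    rw [← map_one (reducedRep G), hψ, map_one]
  · refine hdr.induction_on₂ (isClosed_eq ?_ ?_) fun a b => ?_
    · exact ψ.continuous.comp (continuous_fst.mul continuous_snd)
    · exact (ψ.continuous.comp continuous_fst).mul (ψ.continuous.comp continuous_snd)
    · change ψ (_ * _) = ψ _ * ψ _
      rw [← map_mul, hψ, hψ, hψ, map_mul]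
  · intro r
    change ψ (algebraMap ℂ _ r) = _
    rw [← AlgHomClass.commutes (reducedRep G) r, hψ, AlgHomClass.commutes]
  · intro x
    refine hdr.induction_on x (isClosed_eq ?_ ?_) fun a => ?_
    · exact ψ.continuous.comp continuous_star
    · exact continuous_star.comp ψ.continuous
    · change ψ (star _) = star (ψ _)
      rw [← map_star, hψ, hψ, map_star]
  · ext a
    exact hψ a
  · intro ψ' hψ'
    apply DFunLike.ext'
    refine hdr.equalizer (map_continuous ψ') ψ.continuous (funext fun a => ?_)
    exact (DFunLike.congr_fun hψ' a).trans (hψ a).symm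

/-- Evaluation at the identity is a unital `*`-homomorphism, so universality applies with target
`ℂ`. -/
theorem exists_counit_extension : ∃ χ : reducedAlgebra G →⋆ₐ[ℂ] ℂ,
    ∀ a : regularFunctions G, χ (reducedRep G a) = (a : C(G, ℂ)) 1 := by
  obtain ⟨χ, hχ, -⟩ := isEnvelopingCStarAlgebra_reducedRep ℂ
    ((ContinuousMap.evalStarAlgHom ℂ ℂ (1 : G)).comp (regularFunctions G).subtype)
  exact ⟨χ, fun a => DFunLike.congr_fun hχ a⟩

end envelope

/-! ### Characters of unitary representations. -/

namespace UnitaryRep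

section character

variable {G : Type u} [Group G] [TopologicalSpace G]

theorem trace_rep_eq_sum (U : UnitaryRep G) (g : G) :
    U.rep.character g = ∑ i, inner ℂ (stdOrthonormalBasis ℂ U.space i)
      (U.ρ g (stdOrthonormalBasis ℂ U.space i)) :=
  LinearMap.trace_eq_sum_inner _ (stdOrthonormalBasis ℂ U.space)

/-- The character of a unitary representation, as a continuous function. -/
noncomputable def char (U : UnitaryRep G) : C(G, ℂ) where
  toFun := U.rep.character
  continuous_toFun := by
    simp only [funext (trace_rep_eq_sum U)]
    exact continuous_finsetSum _ fun i _ => continuous_const.inner (U.continuous_apply _)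

theorem char_apply (U : UnitaryRep G) (g : G) : U.char g = U.rep.character g := rfl

theorem char_one (U : UnitaryRep G) : U.char 1 = U.dim := Representation.char_one U.rep

theorem norm_char_apply_le (U : UnitaryRep G) (g : G) : ‖U.char g‖ ≤ U.dim := by
  rw [char_apply, trace_rep_eq_sum]
  calc _ ≤ ∑ i : Fin (Module.finrank ℂ U.space), (1 : ℝ) := norm_sum_le_of_le _ fun i _ => by
        refine (norm_inner_le_norm _ _).trans ?_
        simp
    _ = U.dim := by simp [dim]

theorem char_inv (U : UnitaryRep G) (g : G) : U.char g⁻¹ = star (U.char g) := by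
  rw [char_apply, char_apply, trace_rep_eq_sum, trace_rep_eq_sum, star_sum]
  refine Finset.sum_congr rfl fun i _ => ?_
  rw [← inner_ρ]
  exact (inner_conj_symm _ _).symm

theorem char_tensor (U V : UnitaryRep G) : (U ⊗ V).char = U.char * V.char :=
  ContinuousMap.ext fun g => LinearMap.trace_tensorProduct' (U.rep g) (V.rep g)

theorem char_tensorUnit : (𝟙_ (UnitaryRep G)).char = 1 := by
  ext g
  change LinearMap.trace ℂ ℂ (1 : Module.End ℂ ℂ) = 1
  rw [LinearMap.trace_one]
  simp

/-- An isomorphism of representations, as a linear equivalence. -/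
def isoEquiv {U V : UnitaryRep G} (e : U ≅ V) : U.space ≃ₗ[ℂ] V.space :=
  .ofLinearMap e.hom.hom.toLinearMap e.inv.hom.toLinearMap
    (congrArg (fun f : V ⟶ V => f.hom.toLinearMap) e.inv_hom_id)
    (congrArg (fun f : U ⟶ U => f.hom.toLinearMap) e.hom_inv_id)

theorem char_eq_of_iso {U V : UnitaryRep G} (e : U ≅ V) : U.char = V.char := by
  ext g
  have h : V.rep g = (isoEquiv e).conj (U.rep g) := by
    ext v
    refine (congrArg (V.ρ g) ((isoEquiv e).apply_symm_apply v).symm).trans ?_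
    exact (hom_comm e.hom g _).symm
  rw [char_apply, char_apply, Representation.character, Representation.character, h,
    LinearMap.trace_conj']

/-- Morphisms of unitary representations are intertwining maps, linearly. -/
def homLinearEquiv (U V : UnitaryRep G) :
    (U ⟶ V) ≃ₗ[ℂ] Representation.IntertwiningMap U.rep V.rep where
  __ := homEquiv U V
  map_add' _ _ := rfl
  map_smul' _ _ := rfl

/-- This supplies the weak continuity needed to average over `G` in `Hom(U, V)`. Expanding in rank
one operators reduces it to matrix coefficients at `g⁻¹`. -/
theorem continuous_linHom [IsTopologicalGroup G] (U V : UnitaryRep G)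
    (φ : Module.Dual ℂ (U.space →ₗ[ℂ] V.space)) (T : U.space →ₗ[ℂ] V.space) :
    Continuous fun g => φ (Representation.linHom U.rep V.rep g T) := by
  let e := stdOrthonormalBasis ℂ U.space
  let f := stdOrthonormalBasis ℂ V.space
  have hS : ∀ S : U.space →ₗ[ℂ] V.space, S = ∑ i, ∑ j, inner ℂ (f j) (S (e i)) •
      ((LinearMap.toSpanSingleton ℂ V.space (f j)) ∘ₗ (innerₛₗ ℂ (e i))) := by
    intro S
    refine e.toBasis.ext fun k => ?_
    simp only [OrthonormalBasis.coe_toBasis, LinearMap.sum_apply, LinearMap.smul_apply,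
      LinearMap.comp_apply, LinearMap.toSpanSingleton_apply, innerₛₗ_apply_apply]
    simp [orthonormal_iff_ite.1 e.orthonormal, f.sum_repr']
  have h : ∀ g, φ (Representation.linHom U.rep V.rep g T) =
      ∑ i, ∑ j, inner ℂ (V.ρ g⁻¹ (f j)) (T (U.ρ g⁻¹ (e i))) *
        φ ((LinearMap.toSpanSingleton ℂ V.space (f j)) ∘ₗ (innerₛₗ ℂ (e i))) := by
    intro g
    rw [hS (Representation.linHom U.rep V.rep g T)]
    simp only [map_sum, map_smul, smul_eq_mul]
    refine Finset.sum_congr rfl fun i _ => Finset.sum_congr rfl fun j _ => ?_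
    rw [inner_ρ, inv_inv]
    rfl
  simp only [h]
  refine continuous_finsetSum _ fun i _ => continuous_finsetSum _ fun j _ => ?_
  refine Continuous.mul (Continuous.inner ?_ ?_) continuous_const
  · exact (V.continuous_apply (f j)).comp continuous_inv
  · exact T.continuous_of_finiteDimensional.comp ((U.continuous_apply (e i)).comp continuous_inv)

end character

/-! ### Averaging over the group and scalar products of characters. -/

section average

variable {G : Type u} [Group G] [TopologicalSpace G] [IsTopologicalGroup G] [CompactSpace G]
  [MeasurableSpace G] [BorelSpace G]

/-- The integral of the character of a (weakly continuous) representation is the dimension of the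
space of invariant vectors. -/
theorem finrank_invariants_eq_integral {W : Type*} [AddCommGroup W] [Module ℂ W]
    [FiniteDimensional ℂ W] (ρ : Representation ℂ G W)
    (hρ : ∀ (φ : Module.Dual ℂ W) (w : W), Continuous fun g => φ (ρ g w)) :
    (Module.finrank ℂ ρ.invariants : ℂ) = ∫ g, ρ.character g ∂haarProb G := by
  have hi : ∀ (φ : Module.Dual ℂ W) (w : W), Integrable (fun g => φ (ρ g w)) (haarProb G) :=
    fun φ w => integrable_haarProb (hρ φ w)
  -- The average of the operators `ρ g`, defined weakly through the bidual so that `W` needs no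
  -- norm.
  let P : W →ₗ[ℂ] W := (Module.evalEquiv ℂ W).symm.toLinearMap ∘ₗ
    { toFun := fun w =>
        { toFun := fun φ => ∫ g, φ (ρ g w) ∂haarProb G
          map_add' := fun φ ψ => integral_add (hi φ w) (hi ψ w)
          map_smul' := fun c φ => integral_const_mul c _ }
      map_add' := fun v w => by
        ext φ
        simp only [map_add, LinearMap.coe_mk, AddHom.coe_mk, LinearMap.add_apply]
        exact integral_add (hi φ v) (hi φ w)
      map_smul' := fun c w => by
        ext φ
        simp only [map_smul, LinearMap.coe_mk, AddHom.coe_mk, LinearMap.smul_apply,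
          RingHom.id_apply, smul_eq_mul]
        exact integral_const_mul c _ }
  have hP : ∀ (φ : Module.Dual ℂ W) (w : W), φ (P w) = ∫ g, φ (ρ g w) ∂haarProb G := by
    intro φ w
    simp only [P, LinearMap.comp_apply, LinearEquiv.coe_coe, Module.apply_evalEquiv_symm_apply]
    rfl
  have hproj : LinearMap.IsProj ρ.invariants P := by
    refine ⟨fun w g => ?_, fun w hw => ?_⟩
    · rw [← sub_eq_zero, ← Module.forall_dual_apply_eq_zero_iff ℂ]
      intro φ
      have h1 : φ (ρ g (P w)) = ∫ x, φ (ρ (g * x) w) ∂haarProb G := by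
        rw [← LinearMap.comp_apply, hP]
        simp
      rw [map_sub, h1, hP, sub_eq_zero]
      exact integral_mul_left_eq_self (fun x => φ (ρ x w)) g
    · rw [← sub_eq_zero, ← Module.forall_dual_apply_eq_zero_iff ℂ]
      intro φ
      rw [map_sub, hP, sub_eq_zero]
      have hw' : ∀ g, ρ g w = w := hw
      simp [hw']
  -- The dimension of the invariants is the trace of the projection `P`, and the trace is a finite
  -- sum of functionals that commute with the integral.
  rw [← hproj.trace]
  let b := Module.finBasis ℂ W
  have ht : ∀ T : W →ₗ[ℂ] W, LinearMap.trace ℂ W T = ∑ i, b.coord i (T (b i)) := fun T => by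
    rw [LinearMap.trace_eq_matrix_trace ℂ b, Matrix.trace]
    simp [LinearMap.toMatrix_apply]
  simp only [Representation.character, ht, hP]
  rw [integral_finsetSum _ fun i _ => hi _ _]

/-- The dimension of the space of morphisms is the scalar product of the characters. -/
theorem finrank_hom_eq_integral (U V : UnitaryRep G) :
    (Module.finrank ℂ (U ⟶ V) : ℂ) = ∫ g, star (U.char g) * V.char g ∂haarProb G := by
  rw [(homLinearEquiv U V).finrank_eq,
    ← (Representation.invariantsEquivIntertwiningMap U.rep V.rep).finrank_eq,
    finrank_invariants_eq_integral _ (continuous_linHom U V)]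
  refine integral_congr_ae (.of_forall fun g => ?_)
  change (Representation.linHom U.rep V.rep).character g = _
  rw [Representation.char_linHom]
  exact congrArg (· * V.char g) (char_inv U g)

end average

end UnitaryRep

/-! ### Complete reducibility. -/

namespace UnitaryRep

variable {G : Type u} [Group G] [TopologicalSpace G]

/-- The restriction of a unitary representation to an invariant subspace. -/
noncomputable def restrict (U : UnitaryRep G) (W : Submodule ℂ U.space) (hW : ∀ g, ∀ v ∈ W, U.ρ g v ∈ W) :
    UnitaryRep G where
  space := ⟨W⟩
  ρ :=
    { toFun := fun g =>
        { toFun := fun v => ⟨U.ρ g v, hW g v v.2⟩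
          invFun := fun v => ⟨U.ρ g⁻¹ v, hW g⁻¹ v v.2⟩
          map_add' := fun v w => Subtype.ext (map_add (U.ρ g) _ _)
          map_smul' := fun c v => Subtype.ext (map_smul (U.ρ g) _ _)
          left_inv := fun v => Subtype.ext <| by
            change (U.ρ g⁻¹ * U.ρ g) v = v
            rw [← map_mul, inv_mul_cancel, map_one]; rfl
          right_inv := fun v => Subtype.ext <| by
            change (U.ρ g * U.ρ g⁻¹) v = v
            rw [← map_mul, mul_inv_cancel, map_one]; rfl
          norm_map' := fun v => (U.ρ g).norm_map v }
      map_one' := by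
        ext v
        exact congrArg (fun T : U.space ≃ₗᵢ[ℂ] U.space => T v) (map_one U.ρ)
      map_mul' := fun g h => by
        ext v
        exact congrArg (fun T : U.space ≃ₗᵢ[ℂ] U.space => T v) (map_mul U.ρ g h) }
  continuous_apply v := (U.continuous_apply v).subtype_mk _

theorem orthogonal_invariant (U : UnitaryRep G) {W : Submodule ℂ U.space}
    (hW : ∀ g, ∀ v ∈ W, U.ρ g v ∈ W) (g : G) (v : U.space) (hv : v ∈ Wᗮ) : U.ρ g v ∈ Wᗮ := by
  rw [Submodule.mem_orthogonal'] at hv ⊢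
  intro w hw
  rw [inner_ρ]
  exact hv _ (hW _ _ hw)

theorem char_eq_add_orthogonal (U : UnitaryRep G) {W : Submodule ℂ U.space}
    (hW : ∀ g, ∀ v ∈ W, U.ρ g v ∈ W) :
    U.char = (U.restrict W hW).char + (U.restrict Wᗮ (U.orthogonal_invariant hW)).char := by
  ext g
  let e := Submodule.prodEquivOfIsCompl W Wᗮ W.isCompl_orthogonal
  let A : W →ₗ[ℂ] W := (U.restrict W hW).rep g
  let B : Wᗮ →ₗ[ℂ] Wᗮ := (U.restrict Wᗮ (U.orthogonal_invariant hW)).rep g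
  have h : U.rep g = e.conj (A.prodMap B) := by
    ext v
    obtain ⟨⟨x, y⟩, rfl⟩ := e.surjective v
    rw [LinearEquiv.conj_apply_apply, e.symm_apply_apply]
    simp only [e, LinearMap.prodMap_apply, Submodule.coe_prodEquivOfIsCompl', map_add]
    rfl
  have ht : LinearMap.trace ℂ U.space (U.rep g) =
      LinearMap.trace ℂ W A + LinearMap.trace ℂ Wᗮ B := by
    rw [h, LinearMap.trace_conj', LinearMap.trace_prodMap']
  exact ht

/-- Complete reducibility: every character is a combination of irreducible characters. -/
theorem char_mem_span (U : UnitaryRep G) :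
    U.char ∈ Submodule.span ℂ (Set.range fun j : Irr G => j.out.char) := by
  induction h : U.dim using Nat.strong_induction_on generalizing U with
  | _ n ih =>
  subst h
  by_cases hirr : U.rep.IsIrreducible
  · let j : Irr G := Quotient.mk _ ⟨U, hirr⟩
    have hj : IsIsomorphic j.out U := Quotient.mk_out (s := (isIsomorphicSetoid
      (UnitaryRep G)).comap Subtype.val) (⟨U, hirr⟩ : {U : UnitaryRep G // U.rep.IsIrreducible})
    obtain ⟨e⟩ := hj
    rw [← char_eq_of_iso e]
    exact Submodule.subset_span ⟨j, rfl⟩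
  -- The zero representation is not irreducible, but its character is `0` and lies in the span.
  · by_cases h0 : U.dim = 0
    · have : U.char = 0 := by
        ext g
        have := U.norm_char_apply_le g
        rw [h0, Nat.cast_zero] at this
        exact norm_le_zero_iff.1 this
      rw [this]
      exact zero_mem _
    · have hnt : Nontrivial U.space := Module.finrank_pos_iff.1 (Nat.pos_of_ne_zero h0)
      have : ∃ S : Subrepresentation U.rep, S.toSubmodule ≠ ⊥ ∧ S.toSubmodule ≠ ⊤ := by
        by_contra! hS
        refine hirr { exists_pair_ne := ⟨⊥, ⊤, fun h => ?_⟩, eq_bot_or_eq_top := fun S => ?_ }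
        · exact bot_ne_top (congrArg Subrepresentation.toSubmodule h)
        · by_cases hb : S.toSubmodule = ⊥
          · exact Or.inl (Subrepresentation.toSubmodule_injective hb)
          · exact Or.inr (Subrepresentation.toSubmodule_injective (hS S hb))
      obtain ⟨S, hb, ht⟩ := this
      have hS : ∀ g, ∀ v ∈ S.toSubmodule, U.ρ g v ∈ S.toSubmodule :=
        fun g v hv => S.apply_mem_toSubmodule g hv
      rw [U.char_eq_add_orthogonal hS]
      refine add_mem (ih _ ?_ _ rfl) (ih _ ?_ _ rfl)
      · exact Submodule.finrank_lt ht
      · refine Submodule.finrank_lt fun h => hb ?_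
        exact (Submodule.orthogonal_eq_top_iff _).1 h

/-- The span of the characters of irreducible representations is an algebra. -/
theorem adjoin_char_le : (Subalgebra.toSubmodule
    (Algebra.adjoin ℂ (Set.range fun U : UnitaryRep G => U.char))) ≤
      Submodule.span ℂ (Set.range fun j : Irr G => j.out.char) := by
  -- Tensor products make the characters a multiplicative monoid, so the algebra they generate is
  -- merely their linear span.
  let M : Submonoid C(G, ℂ) :=
    { carrier := Set.range fun U : UnitaryRep G => U.char
      one_mem' := ⟨𝟙_ _, char_tensorUnit⟩
      mul_mem' := by
        rintro _ _ ⟨U, rfl⟩ ⟨V, rfl⟩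
        exact ⟨U ⊗ V, char_tensor U V⟩ }
  rw [Algebra.adjoin_eq_span, show (Set.range fun U : UnitaryRep G => U.char) = (M : Set _) from rfl,
    Submonoid.closure_eq, Submodule.span_le]
  rintro _ ⟨U, rfl⟩
  exact char_mem_span U

end UnitaryRep

/-! ### Irreducible representations and Schur's lemma. -/

namespace Irr

variable {G : Type u} [Group G] [TopologicalSpace G]

instance (j : Irr G) : j.out.rep.IsIrreducible := (Quotient.out j).2

theorem dim_pos (j : Irr G) : 0 < j.dim := by
  have h : j.out.rep.IsIrreducible := inferInstance
  have : Nontrivial j.out.space := by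
    by_contra hn
    rw [not_nontrivial_iff_subsingleton] at hn
    exact bot_ne_top (α := Subrepresentation j.out.rep)
      (Subrepresentation.toSubmodule_injective (Subsingleton.elim _ _))
  exact Nat.cast_pos.2 Module.finrank_pos

/-- Schur's lemma. Isomorphism in `UnitaryRep` only asks for an invertible intertwiner, so a
`Representation.Equiv` of representatives already identifies the classes. -/
theorem finrank_hom_out [DecidableEq (Irr G)] (i k : Irr G) :
    Module.finrank ℂ (i.out ⟶ k.out) = if i = k then 1 else 0 := by
  rw [(UnitaryRep.homLinearEquiv _ _).finrank_eq]
  split_ifs with h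
  · subst h
    exact Representation.IsIrreducible.finrank_intertwiningMap_self _
  · have : IsEmpty (Representation.Equiv i.out.rep k.out.rep) := by
      refine ⟨fun e => h ?_⟩
      have hik : IsIsomorphic i.out k.out :=
        ⟨UnitaryRep.mkIso e.toLinearEquiv fun g v => LinearMap.congr_fun (e.isIntertwining' g) v⟩
      exact Quotient.out_equiv_out.1 hik
    exact Module.finrank_zero_of_subsingleton

theorem norm_char_le [CompactSpace G] (j : Irr G) : ‖j.out.char‖ ≤ j.dim :=
  (ContinuousMap.norm_le _ j.dim_pos.le).2 fun g => j.out.norm_char_apply_le g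

end Irr

/-! ### Amenability of the fusion ring. -/

section fusion

open ContinuousMap (toLp)

variable {G : Type u} [Group G] [TopologicalSpace G] [IsTopologicalGroup G] [CompactSpace G]
  [MeasurableSpace G] [BorelSpace G]

theorem inner_toLp_haarProb (f g : C(G, ℂ)) :
    inner ℂ (toLp 2 (haarProb G) ℂ f) (toLp 2 (haarProb G) ℂ g) =
      ∫ x, star (f x) * g x ∂haarProb G := by
  rw [ContinuousMap.inner_toLp]
  simp only [mul_comm]
  rfl

/-- The irreducible characters are orthonormal in `L²(G)`. -/
theorem orthonormal_char :
    Orthonormal ℂ fun j : Irr G => toLp 2 (haarProb G) ℂ j.out.char := by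
  classical
  rw [orthonormal_iff_ite]
  intro i k
  rw [inner_toLp_haarProb, ← UnitaryRep.finrank_hom_eq_integral, Irr.finrank_hom_out]
  split_ifs <;> simp

/-- The isometric embedding of `ℓ²(Irr G)` in `L²(G)` given by the irreducible characters. -/
noncomputable def charIsometry (G : Type u) [Group G] [TopologicalSpace G] [IsTopologicalGroup G]
    [CompactSpace G] [MeasurableSpace G] [BorelSpace G] :
    lp (fun _ : Irr G => ℂ) 2 →ₗᵢ[ℂ] L2 G :=
  (orthonormal_char (G := G)).orthogonalFamily.linearIsometry

theorem charIsometry_single [DecidableEq (Irr G)] (j : Irr G) :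
    charIsometry G (lp.single 2 j 1) = toLp 2 (haarProb G) ℂ j.out.char :=
  ((orthonormal_char (G := G)).orthogonalFamily.linearIsometry_apply_single _).trans
    (LinearIsometry.toSpanSingleton_apply _ _ |>.trans (one_smul _ _))

/-- The range of an isometry is closed, and uniform convergence implies `L²` convergence. This
allows the compression to be tested on powers of functions in the closed algebra of characters. -/
theorem toLp_mem_range_charIsometry {f : C(G, ℂ)}
    (hf : f ∈ (Algebra.adjoin ℂ
      (Set.range fun U : UnitaryRep G => U.char)).topologicalClosure) :
    ∃ x, charIsometry G x = toLp 2 (haarProb G) ℂ f := by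
  classical
  let K : Submodule ℂ (L2 G) := LinearMap.range (charIsometry G).toLinearMap
  have hK : IsClosed (K : Set (L2 G)) :=
    (charIsometry G).isometry.isClosedEmbedding.isClosed_range
  have h1 : Submodule.span ℂ (Set.range fun j : Irr G => j.out.char) ≤
      K.comap (toLp 2 (haarProb G) ℂ).toLinearMap := by
    rw [Submodule.span_le]
    rintro _ ⟨j, rfl⟩
    exact ⟨lp.single 2 j 1, charIsometry_single j⟩
  have h2 : ((Algebra.adjoin ℂ (Set.range fun U : UnitaryRep G => U.char)).topologicalClosure :
      Set C(G, ℂ)) ⊆ toLp 2 (haarProb G) ℂ ⁻¹' K :=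
    closure_minimal (fun g hg => h1 (UnitaryRep.adjoin_char_le hg))
      (hK.preimage (toLp 2 (haarProb G) ℂ).continuous)
  exact h2 hf

/-- The compression of multiplication operators to the span of the characters. -/
noncomputable def charCompression (G : Type u) [Group G] [TopologicalSpace G]
    [IsTopologicalGroup G] [CompactSpace G] [MeasurableSpace G] [BorelSpace G] :
    C(G, ℂ) →ₗ[ℂ] (lp (fun _ : Irr G => ℂ) 2 →L[ℂ] lp (fun _ : Irr G => ℂ) 2) where
  toFun f := ContinuousLinearMap.adjoint (charIsometry G).toContinuousLinearMap ∘L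
    (mulRep G f ∘L (charIsometry G).toContinuousLinearMap)
  map_add' f g := by
    rw [map_add, ContinuousLinearMap.add_comp, ContinuousLinearMap.comp_add]
  map_smul' c f := by
    rw [map_smul, ContinuousLinearMap.smul_comp, ContinuousLinearMap.comp_smul]
    rfl

/-- A `*`-homomorphism of C*-algebras is contractive. Continuity carries the uniformly convergent
series of characters to a norm convergent series of operators. -/
theorem continuous_charCompression : Continuous (charCompression G) := by
  have h : Continuous (mulRep G) :=
    AddMonoidHomClass.continuous_of_bound (mulRep G) 1 fun f => by
      rw [one_mul]; exact NonUnitalStarAlgHom.norm_apply_le (mulRep G) f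
  exact continuous_const.clm_comp (h.clm_comp continuous_const)

/-- The matrix entry is the scalar product of `χ_i` with `χ_j χ_k`, the character of `j ⊗ k`. Hence
the compression of `χ_j` is the bounded extension of `Λ_j`. -/
theorem charCompression_char_apply [DecidableEq (Irr G)] (i j k : Irr G) :
    charCompression G j.out.char (lp.single 2 k 1) i = Irr.fusion j k i := by
  have h : inner ℂ (lp.single 2 i (1 : ℂ) : lp (fun _ : Irr G => ℂ) 2)
      (charCompression G j.out.char (lp.single 2 k 1)) =
      charCompression G j.out.char (lp.single 2 k 1) i := by
    rw [lp.inner_single_left]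
    simp
  rw [← h]
  change inner ℂ _ (ContinuousLinearMap.adjoint (charIsometry G).toContinuousLinearMap
    (mulOp G j.out.char (charIsometry G (lp.single 2 k 1)))) = _
  rw [ContinuousLinearMap.adjoint_inner_right]
  change inner ℂ (charIsometry G (lp.single 2 i 1)) _ = _
  rw [charIsometry_single, charIsometry_single, mulOp_toLp, inner_toLp_haarProb, Irr.fusion,
    UnitaryRep.finrank_hom_eq_integral, UnitaryRep.char_tensor]

/-- If a continuous function `f` in the closed span of the characters satisfies `‖f‖ ≤ 1` and
`f 1 = 1`, then `1` is in the spectrum of the compression of `f`. -/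
theorem one_mem_spectrum_charCompression {f : C(G, ℂ)}
    (hf : f ∈ (Algebra.adjoin ℂ
      (Set.range fun U : UnitaryRep G => U.char)).topologicalClosure)
    (hn : ∀ x, ‖f x‖ ≤ 1) (h1 : f 1 = 1) : (1 : ℂ) ∈ spectrum ℂ (charCompression G f) := by
  by_contra hspec
  rw [spectrum.notMem_iff, map_one] at hspec
  obtain ⟨S, hS⟩ := hspec.exists_left_inv
  -- Adding `1` ensures `C ≥ 1`, so that the decay ratio `1 - (C ^ 2 * 4)⁻¹` below is nonnegative.
  let C : ℝ := ‖S‖ + 1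
  have hC : 1 ≤ C := by simp [C]
  let h : C(G, ℂ) := (2⁻¹ : ℂ) • (1 + f)
  let I : ℕ → ℝ := fun n => ∫ x, (‖h x‖ ^ 2) ^ n ∂haarProb G
  have hIi : ∀ n, Integrable (fun x => (‖h x‖ ^ 2) ^ n) (haarProb G) := fun n =>
    integrable_haarProb (by fun_prop)
  -- The parallelogram law for `1` and `f x`, with `‖f x‖ ≤ 1`: where `|h|` is near `1`, `f` is near
  -- `1`.
  have hpt : ∀ x, ‖f x - 1‖ ^ 2 ≤ 4 * (1 - ‖h x‖ ^ 2) := by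
    intro x
    have hp := parallelogram_law_with_norm ℝ (1 : ℂ) (f x)
    have hh : ‖h x‖ = 2⁻¹ * ‖1 + f x‖ := by
      simp only [h, ContinuousMap.smul_apply, norm_smul, ContinuousMap.add_apply,
        ContinuousMap.one_apply]
      norm_num
    have h2 := hn x
    rw [hh, norm_sub_rev]
    rw [norm_one] at hp
    nlinarith [norm_nonneg (f x)]
  -- The left inverse bounds `‖h^n‖` by `C ‖(f - 1) h^n‖` in `L²`. With `hpt`, a gap at `1` becomes
  -- a definite loss from each moment to the next.
  have hstep : ∀ n, I n ≤ C ^ 2 * (4 * (I n - I (n + 1))) := by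
    intro n
    have hmem : h ^ n ∈ (Algebra.adjoin ℂ
        (Set.range fun U : UnitaryRep G => U.char)).topologicalClosure :=
      pow_mem (Subalgebra.smul_mem _ (add_mem (one_mem _) hf) _) n
    obtain ⟨x, hx⟩ := toLp_mem_range_charIsometry hmem
    have hVV : ContinuousLinearMap.adjoint (charIsometry G).toContinuousLinearMap
        (charIsometry G x) = x := by
      refine ext_inner_left ℂ fun y => ?_
      rw [ContinuousLinearMap.adjoint_inner_right]
      exact (charIsometry G).inner_map_map y x
    have hTx : (1 - charCompression G f) x =
        -ContinuousLinearMap.adjoint (charIsometry G).toContinuousLinearMap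
          (toLp 2 (haarProb G) ℂ ((f - 1) * h ^ n)) := by
      have : charCompression G f x =
          ContinuousLinearMap.adjoint (charIsometry G).toContinuousLinearMap
            (mulOp G f (charIsometry G x)) := rfl
      rw [sub_apply, this, one_apply_eq_self, sub_mul, one_mul, map_sub, map_sub, ← mulOp_toLp,
        ← hx, hVV]
      abel
    have hVn : ‖ContinuousLinearMap.adjoint (charIsometry G).toContinuousLinearMap‖ ≤ 1 := by
      rw [LinearIsometryEquiv.norm_map]
      exact (charIsometry G).norm_toContinuousLinearMap_le
    have hle : ‖(1 - charCompression G f) x‖ ≤ ‖toLp 2 (haarProb G) ℂ ((f - 1) * h ^ n)‖ := by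
      rw [hTx, norm_neg]
      refine (ContinuousLinearMap.le_opNorm _ _).trans ?_
      exact mul_le_of_le_one_left (norm_nonneg _) hVn
    have hxS : ‖x‖ ≤ C * ‖toLp 2 (haarProb G) ℂ ((f - 1) * h ^ n)‖ := by
      have hSx : S ((1 - charCompression G f) x) = x :=
        DFunLike.congr_fun hS x
      calc ‖x‖ = ‖S ((1 - charCompression G f) x)‖ := by rw [hSx]
        _ ≤ ‖S‖ * ‖(1 - charCompression G f) x‖ := S.le_opNorm _
        _ ≤ C * _ := mul_le_mul (by simp [C]) hle (norm_nonneg _) (by positivity)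
    have hxn : ‖x‖ ^ 2 = I n := by
      rw [← (charIsometry G).norm_map x, hx, norm_toLp_sq]
      refine integral_congr_ae (.of_forall fun y => ?_)
      simp only [ContinuousMap.pow_apply, norm_pow]
      rw [← pow_mul, ← pow_mul, mul_comm]
    have hfn : ‖toLp 2 (haarProb G) ℂ ((f - 1) * h ^ n)‖ ^ 2 ≤ 4 * (I n - I (n + 1)) := by
      rw [norm_toLp_sq, ← integral_sub (hIi n) (hIi (n + 1)), ← integral_const_mul]
      refine integral_mono (integrable_haarProb (by fun_prop))
        (((hIi n).sub (hIi (n + 1))).const_mul 4) fun y => ?_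
      have := mul_le_mul_of_nonneg_right (hpt y) (by positivity : 0 ≤ (‖h y‖ ^ 2) ^ n)
      calc ‖((f - 1) * h ^ n) y‖ ^ 2 = ‖f y - 1‖ ^ 2 * (‖h y‖ ^ 2) ^ n := by
            simp only [ContinuousMap.mul_apply, ContinuousMap.pow_apply, norm_mul, norm_pow,
              mul_pow, ← pow_mul, ContinuousMap.sub_apply, ContinuousMap.one_apply]
            rw [mul_comm n 2]
        _ ≤ _ := this
        _ = _ := by simp only [pow_succ]; ring
    calc I n = ‖x‖ ^ 2 := hxn.symm
      _ ≤ (C * ‖toLp 2 (haarProb G) ℂ ((f - 1) * h ^ n)‖) ^ 2 :=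
        pow_le_pow_left₀ (norm_nonneg _) hxS 2
      _ = C ^ 2 * ‖toLp 2 (haarProb G) ℂ ((f - 1) * h ^ n)‖ ^ 2 := mul_pow _ _ _
      _ ≤ _ := mul_le_mul_of_nonneg_left hfn (by positivity)
  have ha : 1 ≤ C ^ 2 * 4 := by nlinarith
  have hq : 0 ≤ 1 - (C ^ 2 * 4)⁻¹ := sub_nonneg.2 (inv_le_one_of_one_le₀ ha)
  have hdec : ∀ n, I n ≤ 1 * (1 - (C ^ 2 * 4)⁻¹) ^ n := by
    intro n
    induction n with
    | zero => simp [I]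
    | succ n ih =>
      have hs : (C ^ 2 * 4)⁻¹ * I n ≤ I n - I (n + 1) := by
        rw [inv_mul_le_iff₀ (by positivity), mul_assoc]
        exact hstep n
      calc I (n + 1) ≤ (1 - (C ^ 2 * 4)⁻¹) * I n := by linarith
        _ ≤ (1 - (C ^ 2 * 4)⁻¹) * (1 * (1 - (C ^ 2 * 4)⁻¹) ^ n) :=
          mul_le_mul_of_nonneg_left ih hq
        _ = _ := by rw [pow_succ]; ring
  have hfin := le_of_integral_pow_le (f := fun x => ‖h x‖ ^ 2) (by fun_prop)
    (fun x => by positivity) hq hdec 1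
  have hh1 : h 1 = 1 := by
    simp only [h, ContinuousMap.smul_apply, ContinuousMap.add_apply, ContinuousMap.one_apply, h1]
    norm_num
  have hpos : 0 < (C ^ 2 * 4)⁻¹ := by positivity
  simp only [hh1, norm_one, one_pow] at hfin
  linarith

/-- The fusion ring of a compact group with the classical dimension function is amenable. -/
theorem fusionAmenable : FusionAmenable (Irr.fusion (G := G)) Irr.dim := by
  classical
  refine ⟨fun j => charCompression G j.out.char, fun j k i => ?_, fun μ hμ hsum => ?_⟩
  · convert! charCompression_char_apply i j k
  -- Each `χ_j / d_j` is bounded by `1` and equals `1` at the identity. Hence the series is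
  -- dominated by `μ`, its sum has norm at most `1`, and its value at the identity is the total mass
  -- of `μ`.
  let t : Irr G → C(G, ℂ) := fun j => ((μ j / j.dim : ℝ) : ℂ) • j.out.char
  have ht : ∀ j, ‖t j‖ ≤ μ j := fun j => by
    have hd := j.dim_pos
    rw [norm_smul, Complex.norm_real, Real.norm_of_nonneg (div_nonneg (hμ j) hd.le)]
    calc μ j / j.dim * ‖j.out.char‖ ≤ μ j / j.dim * j.dim :=
          mul_le_mul_of_nonneg_left (Irr.norm_char_le j) (div_nonneg (hμ j) hd.le)
      _ = μ j := div_mul_cancel₀ _ hd.ne'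
  have hts : Summable t := .of_norm_bounded hsum.summable ht
  refine ⟨charCompression G (∑' j, t j), ?_, one_mem_spectrum_charCompression ?_ (fun x => ?_) ?_⟩
  · have := hts.hasSum.map (charCompression G) continuous_charCompression
    convert! this using 2 with j
    simp [t]
  · refine (Subalgebra.isClosed_topologicalClosure _).mem_of_tendsto hts.hasSum
      (.of_forall fun s => ?_)
    exact sum_mem fun j _ => Subalgebra.smul_mem _
      (Subalgebra.le_topologicalClosure _ (Algebra.subset_adjoin (Set.mem_range_self j.out))) _
  · exact ((∑' j, t j).norm_coe_le_norm x).trans (tsum_of_norm_bounded hsum ht)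
  · have h1 : HasSum (fun j => t j 1) ((∑' j, t j) 1) :=
      hts.hasSum.map (ContinuousMap.evalCLM ℂ (1 : G)) (ContinuousMap.evalCLM ℂ (1 : G)).continuous
    have h2 : HasSum (fun j => t j 1) 1 := by
      have h3 : HasSum (fun j => ((μ j : ℝ) : ℂ)) ((1 : ℝ) : ℂ) :=
        hsum.map Complex.ofRealCLM Complex.ofRealCLM.continuous
      rw [Complex.ofReal_one] at h3
      convert! h3 using 2 with j
      have hd : (j.out.dim : ℂ) ≠ 0 := Nat.cast_ne_zero.2 (Nat.cast_pos.1 j.dim_pos).ne'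
      simp only [t, ContinuousMap.smul_apply, UnitaryRep.char_one, Irr.dim, smul_eq_mul]
      push_cast
      exact div_mul_cancel₀ _ hd
    exact h1.unique h2

end fusion

/-! ### Conjugate representations and the conjugate equations. -/

theorem inner_tensor_smul_right {E F : Type} [NormedAddCommGroup E] [InnerProductSpace ℂ E]
    [NormedAddCommGroup F] [InnerProductSpace ℂ F] (c : ℂ) (x y : E ⊗[ℂ] F) :
    inner ℂ x (c • y) = c * inner ℂ x y :=
  inner_smul_right x y c

/-- The conjugate of a complex Hilbert space. -/
def ConjSpace (E : Type) : Type := E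

namespace ConjSpace

variable {E : Type} [NormedAddCommGroup E] [InnerProductSpace ℂ E]

instance : NormedAddCommGroup (ConjSpace E) := inferInstanceAs (NormedAddCommGroup E)

noncomputable instance : Module ℂ (ConjSpace E) :=
  Module.compHom E (starRingEnd ℂ)

/-- The identity map, as a map to the conjugate space. -/
def mk (x : E) : ConjSpace E := x

/-- The identity map, as a map from the conjugate space. -/
def get (x : ConjSpace E) : E := x

noncomputable instance : InnerProductSpace ℂ (ConjSpace E) where
  norm_smul_le c x := by
    refine (norm_smul_le ((starRingEnd ℂ) c) (get x)).trans_eq ?_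
    rw [RCLike.norm_conj]
    rfl
  inner x y := inner ℂ y.get x.get
  norm_sq_eq_re_inner x := norm_sq_eq_re_inner (𝕜 := ℂ) x.get
  conj_inner_symm x y := inner_conj_symm y.get x.get
  add_left x y z := inner_add_right z.get x.get y.get
  smul_left x y c := inner_smul_right y.get x.get _

instance [FiniteDimensional ℂ E] : FiniteDimensional ℂ (ConjSpace E) :=
  Module.Finite.of_surjective
    (σ := starRingEnd ℂ)
    ({ toFun := mk
       map_add' := fun _ _ => rfl
       map_smul' := fun c x => by
        change mk (c • x) = mk ((starRingEnd ℂ) ((starRingEnd ℂ) c) • x)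
        rw [Complex.conj_conj] } : E →ₛₗ[starRingEnd ℂ] ConjSpace E) fun x => ⟨x, rfl⟩

section pairing

variable (E)

/-- The inner product of `E`, as a linear form on `conj E ⊗ E`. -/
noncomputable def evL : ConjSpace E ⊗[ℂ] E →ₗ[ℂ] ℂ :=
  TensorProduct.lift
    { toFun := fun x => innerₛₗ ℂ x.get
      map_add' := fun x y => LinearMap.ext fun z => inner_add_left x.get y.get z
      map_smul' := fun c x => LinearMap.ext fun z => by
        change inner ℂ ((starRingEnd ℂ) c • x.get) z = c * inner ℂ x.get z
        rw [inner_smul_left, Complex.conj_conj] }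

/-- The inner product of `E`, as a linear form on `E ⊗ conj E`. -/
noncomputable def evR : E ⊗[ℂ] ConjSpace E →ₗ[ℂ] ℂ :=
  evL E ∘ₗ (TensorProduct.comm ℂ E (ConjSpace E)).toLinearMap

variable {E}

theorem evL_tmul (x : ConjSpace E) (y : E) : evL E (x ⊗ₜ[ℂ] y) = inner ℂ x.get y := rfl

theorem evR_tmul (x : E) (y : ConjSpace E) : evR E (x ⊗ₜ[ℂ] y) = inner ℂ y.get x := rfl

variable [FiniteDimensional ℂ E] {ι : Type*} [Fintype ι] (e : OrthonormalBasis ι ℂ E)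

/-- Parseval's identity. The adjoint of the pairing is the coevaluation, independently of the basis
chosen. -/
theorem adjoint_evL (c : ℂ) :
    LinearMap.adjoint (evL E) c = c • ∑ i, mk (e i) ⊗ₜ[ℂ] e i := by
  refine ext_inner_left ℂ fun z => ?_
  rw [LinearMap.adjoint_inner_right]
  induction z using TensorProduct.induction_on with
  | zero => simp
  | add x y hx hy => rw [map_add, inner_add_left, inner_add_left, hx, hy]
  | tmul x y =>
    have h : inner ℂ (inner ℂ x.get y) c = c * inner ℂ y x.get := by simp
    rw [evL_tmul, h]
    rw [inner_tensor_smul_right, inner_sum, ← e.sum_inner_mul_inner]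
    simp only [TensorProduct.inner_tmul]
    exact congrArg _ (Finset.sum_congr rfl fun i _ => mul_comm _ _)

theorem adjoint_evR (c : ℂ) :
    LinearMap.adjoint (evR E) c = c • ∑ i, e i ⊗ₜ[ℂ] mk (e i) := by
  refine ext_inner_left ℂ fun z => ?_
  rw [LinearMap.adjoint_inner_right]
  induction z using TensorProduct.induction_on with
  | zero => simp
  | add x y hx hy => rw [map_add, inner_add_left, inner_add_left, hx, hy]
  | tmul x y =>
    have h : inner ℂ (inner ℂ y.get x) c = c * inner ℂ x y.get := by simp
    rw [evR_tmul, h]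
    rw [inner_tensor_smul_right, inner_sum, ← e.sum_inner_mul_inner]
    simp only [TensorProduct.inner_tmul]
    rfl

theorem evL_map_adjoint_evL (T : E →ₗ[ℂ] E) (c : ℂ) :
    evL E (TensorProduct.map LinearMap.id T (LinearMap.adjoint (evL E) c)) =
      LinearMap.trace ℂ E T * c := by
  rw [adjoint_evL (stdOrthonormalBasis ℂ E),
    LinearMap.trace_eq_sum_inner T (stdOrthonormalBasis ℂ E)]
  simp only [map_smul, map_sum, TensorProduct.map_tmul, evL_tmul, smul_eq_mul, mul_comm c]
  rfl

theorem evR_adjoint_evR (c : ℂ) :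
    evR E (LinearMap.adjoint (evR E) c) = Module.finrank ℂ E * c := by
  rw [adjoint_evR (stdOrthonormalBasis ℂ E), ← LinearMap.trace_id ℂ E,
    LinearMap.trace_eq_sum_inner _ (stdOrthonormalBasis ℂ E)]
  simp only [map_smul, map_sum, evR_tmul, smul_eq_mul, mul_comm c]
  rfl

/-- The zigzag identity, which here is the expansion `v = ∑ ⟨e_i, v⟩ e_i`. -/
theorem evR_assoc_adjoint_evL (v : E) (c : ℂ) :
    TensorProduct.map (evR E) LinearMap.id ((TensorProduct.assoc ℂ E (ConjSpace E) E).symm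
      (v ⊗ₜ[ℂ] LinearMap.adjoint (evL E) c)) = (1 : ℂ) ⊗ₜ[ℂ] (c • v) := by
  let e := stdOrthonormalBasis ℂ E
  have h : ∀ i, (inner ℂ (e i) v : ℂ) ⊗ₜ[ℂ] e i = (1 : ℂ) ⊗ₜ[ℂ] (inner ℂ (e i) v • e i) := by
    intro i
    rw [TensorProduct.tmul_smul, TensorProduct.smul_tmul', smul_eq_mul, mul_one]
  rw [adjoint_evL e, TensorProduct.tmul_smul, TensorProduct.tmul_sum, TensorProduct.tmul_smul]
  simp only [map_smul, map_sum, TensorProduct.assoc_symm_tmul, TensorProduct.map_tmul, evR_tmul,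
    LinearMap.id_apply]
  rw [← e.sum_repr' v, TensorProduct.tmul_sum, e.sum_repr' v]
  exact congrArg _ (Finset.sum_congr rfl fun i _ => h i)

end pairing

end ConjSpace

namespace UnitaryRep

variable {G : Type u} [Group G] [TopologicalSpace G]

/-- The conjugate representation. -/
noncomputable def conj (U : UnitaryRep G) : UnitaryRep G where
  space := ⟨ConjSpace U.space⟩
  ρ :=
    { toFun := fun g =>
        { toFun := fun v => ConjSpace.mk (U.ρ g v.get)
          invFun := fun v => ConjSpace.mk (U.ρ g⁻¹ v.get)
          map_add' := fun v w => map_add (U.ρ g) _ _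
          map_smul' := fun c v => map_smul (U.ρ g) ((starRingEnd ℂ) c) _
          left_inv := fun v => by
            change (U.ρ g⁻¹ * U.ρ g) v = v
            rw [← map_mul, inv_mul_cancel, map_one]; rfl
          right_inv := fun v => by
            change (U.ρ g * U.ρ g⁻¹) v = v
            rw [← map_mul, mul_inv_cancel, map_one]; rfl
          norm_map' := fun v => (U.ρ g).norm_map v }
      map_one' := by
        ext v
        exact congrArg (fun T : U.space ≃ₗᵢ[ℂ] U.space => T v) (map_one U.ρ)
      map_mul' := fun g h => by
        ext v
        exact congrArg (fun T : U.space ≃ₗᵢ[ℂ] U.space => T v) (map_mul U.ρ g h) }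
  continuous_apply v := U.continuous_apply v

/-- The evaluation `conj U ⊗ U ⟶ 1`. -/
noncomputable def ev (U : UnitaryRep G) : U.conj ⊗ U ⟶ 𝟙_ (UnitaryRep G) :=
  mkHom (ConjSpace.evL U.space) fun g x =>
    LinearMap.congr_fun
      (f := ConjSpace.evL U.space ∘ₗ (tensor U.conj U).rep g)
      (g := ConjSpace.evL U.space)
      (TensorProduct.ext' fun x y => (U.ρ g).inner_map_map (ConjSpace.get x) y) x

/-- The evaluation `U ⊗ conj U ⟶ 1`. -/
noncomputable def ev' (U : UnitaryRep G) : U ⊗ U.conj ⟶ 𝟙_ (UnitaryRep G) :=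
  mkHom (ConjSpace.evR U.space) fun g x =>
    LinearMap.congr_fun
      (f := ConjSpace.evR U.space ∘ₗ (tensor U U.conj).rep g)
      (g := ConjSpace.evR U.space)
      (TensorProduct.ext' fun x y => (U.ρ g).inner_map_map (ConjSpace.get y) x) x

/-- The partial trace of an endomorphism. -/
theorem dagger_ev_whiskerLeft_ev {U : UnitaryRep G} (f : U ⟶ U) :
    dagger U.ev ≫ U.conj ◁ f ≫ U.ev = LinearMap.trace ℂ U.space f.hom.toLinearMap • 𝟙 _ :=
  hom_ext (LinearMap.ext fun c => ConjSpace.evL_map_adjoint_evL (E := U.space) f.hom.toLinearMap c)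

/-- Together with `dagger_ev'_comp_ev'` this normalises both halves of the solution of the conjugate
equations. A unitary fiber functor preserves these constants. -/
theorem dagger_ev_comp_ev (U : UnitaryRep G) : dagger U.ev ≫ U.ev = (U.dim : ℂ) • 𝟙 _ := by
  have h := dagger_ev_whiskerLeft_ev (𝟙 U)
  rw [MonoidalCategory.whiskerLeft_id, Category.id_comp] at h
  rw [h]
  congr 1
  exact LinearMap.trace_id ℂ U.space

theorem dagger_ev'_comp_ev' (U : UnitaryRep G) : dagger U.ev' ≫ U.ev' = (U.dim : ℂ) • 𝟙 _ :=
  hom_ext (LinearMap.ext fun c => ConjSpace.evR_adjoint_evR (E := U.space) c)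

/-- The conjugate equation for `U`. -/
theorem conjugate_equation (U : UnitaryRep G) :
    U ◁ dagger U.ev ≫ (α_ U U.conj U).inv ≫ U.ev' ▷ U = (ρ_ U).hom ≫ (λ_ U).inv :=
  hom_ext (TensorProduct.ext' fun v c => ConjSpace.evR_assoc_adjoint_evL (E := U.space) v c)

end UnitaryRep

/-! ### Norm estimates and dimension in finite dimensional Hilbert spaces. -/

namespace FdHilb

theorem comp_apply {H K L : FdHilb} (f : H ⟶ K) (g : K ⟶ L) (x : H) :
    (f ≫ g).hom x = g.hom (f.hom x) := rfl

/-- Composition is diagrammatic, so the hypothesis reads `f f* = c`: the adjoint is `√c` times an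
isometry. -/
theorem norm_sq_dagger_apply {H K : FdHilb} {f : H ⟶ K} {c : ℝ}
    (hf : dagger f ≫ f = (c : ℂ) • 𝟙 K) (z : K) : ‖(dagger f).hom z‖ ^ 2 = c * ‖z‖ ^ 2 := by
  have h : f.hom ((dagger f).hom z) = (c : ℂ) • z :=
    congrArg (fun g : K ⟶ K => g.hom z) hf
  have h2 : inner ℂ ((dagger f).hom z) ((dagger f).hom z) = inner ℂ z ((c : ℂ) • z) := by
    rw [← h]
    exact LinearMap.adjoint_inner_left _ _ _
  rw [inner_smul_right, inner_self_eq_norm_sq_to_K, inner_self_eq_norm_sq_to_K] at h2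
  refine Complex.ofReal_injective ?_
  push_cast
  exact h2

/-- By Cauchy–Schwarz `‖f z‖² ≤ ‖z‖ ‖f* f z‖ = √c ‖z‖ ‖f z‖`, and one factor `‖f z‖` cancels unless
it is zero. -/
theorem norm_sq_apply_le {H K : FdHilb} {f : H ⟶ K} {c : ℝ} (hc : 0 ≤ c)
    (hf : dagger f ≫ f = (c : ℂ) • 𝟙 K) (z : H) : ‖f.hom z‖ ^ 2 ≤ c * ‖z‖ ^ 2 := by
  have h1 : ‖f.hom z‖ ^ 2 ≤ ‖z‖ * ‖(dagger f).hom (f.hom z)‖ := by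
    refine le_trans (le_of_eq ?_) (norm_inner_le_norm (𝕜 := ℂ) _ _)
    have : inner ℂ z ((dagger f).hom (f.hom z)) = inner ℂ (f.hom z) (f.hom z) :=
      LinearMap.adjoint_inner_right _ _ _
    rw [this, inner_self_eq_norm_sq_to_K]
    simp
  have h2 := norm_sq_dagger_apply hf (f.hom z)
  rcases (norm_nonneg (f.hom z)).eq_or_lt with h0 | h0
  · rw [← h0, zero_pow two_ne_zero]
    positivity
  · have h3 : (‖f.hom z‖ ^ 2) ^ 2 ≤ ‖z‖ ^ 2 * (c * ‖f.hom z‖ ^ 2) := by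
      rw [← h2, ← mul_pow]
      exact pow_le_pow_left₀ (by positivity) h1 2
    refine le_of_mul_le_mul_right ?_ (pow_pos h0 2)
    calc _ = (‖f.hom z‖ ^ 2) ^ 2 := (sq _).symm
      _ ≤ _ := h3
      _ = _ := by ring

theorem norm_apply_of_isUnitary {H K : FdHilb} {f : H ⟶ K} (hf : IsUnitary f) (z : H) :
    ‖f.hom z‖ = ‖z‖ := by
  have h : dagger (dagger f) ≫ dagger f = ((1 : ℝ) : ℂ) • 𝟙 H := by
    have : dagger (dagger f) = f := FdHilb.hom_ext (LinearMap.adjoint_adjoint f.hom)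
    rw [this, hf.1, Complex.ofReal_one, one_smul]
  have h2 := norm_sq_dagger_apply h z
  have : dagger (dagger f) = f := FdHilb.hom_ext (LinearMap.adjoint_adjoint f.hom)
  rw [this, one_mul] at h2
  exact (pow_left_inj₀ (norm_nonneg _) (norm_nonneg _) two_ne_zero).1 h2

/-- The dimension of a Hilbert space in terms of a solution of one of the conjugate equations. -/
theorem finrank_eq_of_conjugate_equation {X Y : FdHilb} (r : 𝟙_ FdHilb ⟶ X ⊗ Y)
    (E : Y ⊗ X ⟶ 𝟙_ FdHilb) (h : Y ◁ r ≫ (α_ Y X Y).inv ≫ E ▷ Y = (ρ_ Y).hom ≫ (λ_ Y).inv) :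
    (Module.finrank ℂ Y : ℂ) = E.hom (TensorProduct.comm ℂ X Y (r.hom (1 : ℂ))) := by
  let e := stdOrthonormalBasis ℂ Y
  -- The trace over `Y` of the zigzag, with `r(1)` replaced by a variable. On simple tensors it
  -- contracts to `E` after the flip; at `r(1)` the zigzag is the identity of `Y`, whose trace is
  -- the dimension.
  let L : X ⊗[ℂ] Y →ₗ[ℂ] ℂ := ∑ k, innerₛₗ ℂ (e k) ∘ₗ (TensorProduct.lid ℂ Y).toLinearMap ∘ₗ
    TensorProduct.map E.hom LinearMap.id ∘ₗ (TensorProduct.assoc ℂ Y X Y).symm.toLinearMap ∘ₗ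
    TensorProduct.mk ℂ Y (X ⊗[ℂ] Y) (e k)
  let E' : Y ⊗[ℂ] X →ₗ[ℂ] ℂ := E.hom
  have hL : L = E' ∘ₗ (TensorProduct.comm ℂ X Y).toLinearMap := by
    refine TensorProduct.ext' fun x y => ?_
    have h1 : L (x ⊗ₜ y) = ∑ k, E' (e k ⊗ₜ x) * inner ℂ (e k) y := by
      simp only [L, LinearMap.sum_apply]
      exact Finset.sum_congr rfl fun k _ => inner_smul_right (e k) y (E' (e k ⊗ₜ x))
    have h2 : E' (y ⊗ₜ x) = ∑ k, E' (e k ⊗ₜ x) * inner ℂ (e k) y := by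
      conv_lhs => rw [← e.sum_repr' y, TensorProduct.sum_tmul, map_sum]
      refine Finset.sum_congr rfl fun k _ => ?_
      rw [← TensorProduct.smul_tmul', map_smul, smul_eq_mul, mul_comm]
    exact h1.trans h2.symm
  have hy : ∀ y : Y, (TensorProduct.lid ℂ Y) (TensorProduct.map E.hom LinearMap.id
      ((TensorProduct.assoc ℂ Y X Y).symm (y ⊗ₜ[ℂ] r.hom (1 : ℂ)))) = y := by
    intro y
    have := congrArg (fun f : Y ⊗ 𝟙_ FdHilb ⟶ 𝟙_ FdHilb ⊗ Y => f.hom (y ⊗ₜ[ℂ] (1 : ℂ))) h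
    have h3 : TensorProduct.map E.hom LinearMap.id
      ((TensorProduct.assoc ℂ Y X Y).symm (y ⊗ₜ[ℂ] r.hom (1 : ℂ))) =
        (1 : ℂ) ⊗ₜ[ℂ] ((1 : ℂ) • y) := this
    rw [h3, one_smul, TensorProduct.lid_tmul, one_smul]
  have hfin : L (r.hom (1 : ℂ)) = Module.finrank ℂ Y := by
    have h4 : L (r.hom (1 : ℂ)) = ∑ k, inner ℂ (e k) (e k) := by
      simp only [L, LinearMap.sum_apply]
      exact Finset.sum_congr rfl fun k _ => congrArg (fun y : Y => inner ℂ (e k) y) (hy (e k))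
    rw [h4]
    simp [inner_self_eq_norm_sq_to_K]
  rw [← hfin, hL]
  rfl

end FdHilb

/-! ### Dimensions under a unitary fiber functor. -/

namespace UnitaryFiberFunctor

open Functor.LaxMonoidal Functor.OplaxMonoidal Functor.Monoidal

attribute [instance] UnitaryFiberFunctor.additive UnitaryFiberFunctor.linear
  UnitaryFiberFunctor.monoidal

variable {G : Type u} [Group G] [TopologicalSpace G] (F : UnitaryFiberFunctor G)

theorem finrank_tensorObj (U V : UnitaryRep G) :
    Module.finrank ℂ (F.toFunctor.obj (U ⊗ V)) =
      Module.finrank ℂ (F.toFunctor.obj U) * Module.finrank ℂ (F.toFunctor.obj V) := by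
  let i := μIso F.toFunctor U V
  let e : (F.toFunctor.obj U ⊗[ℂ] F.toFunctor.obj V) ≃ₗ[ℂ] F.toFunctor.obj (U ⊗ V) :=
    .ofLinearMap i.hom.hom i.inv.hom
      (congrArg FdHilb.Hom.hom i.inv_hom_id) (congrArg FdHilb.Hom.hom i.hom_inv_id)
  rw [← e.finrank_eq, Module.finrank_tensorProduct]

theorem map_unit_ne_zero : 𝟙 (F.toFunctor.obj (𝟙_ (UnitaryRep G))) ≠ 0 := by
  intro h
  have h1 : 𝟙 (𝟙_ FdHilb) = 0 := by
    rw [← ε_η F.toFunctor, ← Category.id_comp (η F.toFunctor), h, Limits.zero_comp,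
      Limits.comp_zero]
  have h2 : (1 : ℂ) = 0 := congrArg (fun f : 𝟙_ FdHilb ⟶ 𝟙_ FdHilb => f.hom (1 : ℂ)) h1
  exact one_ne_zero h2

/-- Faithfulness of `F`. Applying `F` to the partial trace of `f* f` gives `Tr(f* f) = 0`, because
`F(𝟙) ≠ 0`; thus the Hilbert–Schmidt norm of `f` vanishes. -/
theorem map_eq_zero {U V : UnitaryRep G} {f : U ⟶ V} (h : F.toFunctor.map f = 0) : f = 0 := by
  have h1 : F.toFunctor.map (f ≫ UnitaryRep.dagger f) = 0 := by
    rw [F.toFunctor.map_comp, h, Limits.zero_comp]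
  have h2 := congrArg F.toFunctor.map (UnitaryRep.dagger_ev_whiskerLeft_ev (f ≫ UnitaryRep.dagger f))
  have h4 : F.toFunctor.obj U.conj ◁ (0 : F.toFunctor.obj U ⟶ F.toFunctor.obj U) = 0 := by
    apply FdHilb.hom_ext
    exact TensorProduct.ext' fun x y => TensorProduct.tmul_zero _ x
  rw [F.toFunctor.map_comp, F.toFunctor.map_comp, map_whiskerLeft, h1, h4, Limits.zero_comp,
    Limits.comp_zero, Limits.zero_comp, Limits.comp_zero, F.toFunctor.map_smul,
    F.toFunctor.map_id] at h2
  have h3 := (smul_eq_zero.1 h2.symm).resolve_right F.map_unit_ne_zero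
  have h5 : LinearMap.trace ℂ U.space
      (LinearMap.adjoint f.hom.toLinearMap ∘ₗ f.hom.toLinearMap) = 0 := h3
  rw [LinearMap.trace_eq_sum_inner _ (stdOrthonormalBasis ℂ U.space)] at h5
  simp only [LinearMap.comp_apply, LinearMap.adjoint_inner_right,
    inner_self_eq_norm_sq_to_K] at h5
  have h6 : ∑ i, ‖f.hom.toLinearMap (stdOrthonormalBasis ℂ U.space i)‖ ^ 2 = 0 := by
    refine Complex.ofReal_injective ?_
    push_cast
    exact h5
  rw [Finset.sum_eq_zero_iff_of_nonneg fun i _ => sq_nonneg _] at h6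
  refine UnitaryRep.hom_ext ((stdOrthonormalBasis ℂ U.space).toBasis.ext fun i => ?_)
  rw [OrthonormalBasis.coe_toBasis]
  exact norm_eq_zero.1 (pow_eq_zero_iff two_ne_zero |>.1 (h6 i (Finset.mem_univ i)))

theorem finrank_hom_le (U : UnitaryRep G) :
    Module.finrank ℂ (U ⟶ U) ≤ Module.finrank ℂ (F.toFunctor.obj U) ^ 2 := by
  let A : (U ⟶ U) →ₗ[ℂ] (F.toFunctor.obj U →ₗ[ℂ] F.toFunctor.obj U) :=
    { toFun := fun f => (F.toFunctor.map f).hom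
      map_add' := fun f g => congrArg FdHilb.Hom.hom (F.toFunctor.map_add)
      map_smul' := fun c f => congrArg FdHilb.Hom.hom (Functor.Linear.map_smul f c) }
  have hA : Function.Injective A := by
    rw [injective_iff_map_eq_zero]
    exact fun f hf => F.map_eq_zero (FdHilb.hom_ext hf)
  refine (LinearMap.finrank_le_finrank_of_injective hA).trans_eq ?_
  rw [Module.finrank_linearMap, sq]

/-- The conjugate equations give an upper bound on dimensions. -/
theorem finrank_obj_le (U : UnitaryRep G) :
    (Module.finrank ℂ (F.toFunctor.obj U) : ℝ) ≤ U.dim := by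
  -- `R` and `E` are the images under `F` of the coevaluation and evaluation, transported by the
  -- tensor structure; they again satisfy a conjugate equation.
  let R : 𝟙_ FdHilb ⟶ F.toFunctor.obj U.conj ⊗ F.toFunctor.obj U :=
    ε F.toFunctor ≫ F.toFunctor.map (UnitaryRep.dagger U.ev) ≫ δ F.toFunctor U.conj U
  let E : F.toFunctor.obj U ⊗ F.toFunctor.obj U.conj ⟶ 𝟙_ FdHilb :=
    μ F.toFunctor U U.conj ≫ F.toFunctor.map U.ev' ≫ η F.toFunctor
  have hconj := congrArg F.toFunctor.map U.conjugate_equation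
  have hRE : F.toFunctor.obj U ◁ R ≫ (α_ _ _ _).inv ≫ E ▷ F.toFunctor.obj U =
      (ρ_ (F.toFunctor.obj U)).hom ≫ (λ_ (F.toFunctor.obj U)).inv := by
    rw [map_associator_inv']
    simp only [R, E, whiskerLeft_comp, comp_whiskerRight, Category.assoc,
      whiskerLeft_δ_μ_assoc, whiskerRight_δ_μ_assoc, μ_natural_right_assoc]
    rw [δ_natural_left_assoc, ← F.toFunctor.map_comp_assoc, ← F.toFunctor.map_comp_assoc, Category.assoc, hconj,
      F.toFunctor.map_comp, map_rightUnitor, map_leftUnitor_inv]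
    simp
  -- Now `dim F(U)` is the value of `E` at the flip of `R(1)`. As the structure maps are isometric,
  -- `‖E‖² ≤ dim U` and `‖R(1)‖² = dim U`, so this value is at most `dim U`.
  have hfin := FdHilb.finrank_eq_of_conjugate_equation R E hRE
  have hε := FdHilb.norm_apply_of_isUnitary F.unitary_ε
  have hμ := fun V W => FdHilb.norm_apply_of_isUnitary (F.unitary_μ V W)
  have hη : ∀ z, ‖(η F.toFunctor).hom z‖ = ‖z‖ := fun z => by
    rw [← hε, ← FdHilb.comp_apply, η_ε]; rfl
  have hδ : ∀ V W z, ‖(δ F.toFunctor V W).hom z‖ = ‖z‖ := fun V W z => by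
    rw [← hμ, ← FdHilb.comp_apply, δ_μ]; rfl
  have hev : FdHilb.dagger (F.toFunctor.map U.ev) ≫ F.toFunctor.map U.ev =
      ((U.dim : ℝ) : ℂ) • 𝟙 _ := by
    rw [← F.map_dagger, ← F.toFunctor.map_comp, U.dagger_ev_comp_ev, F.toFunctor.map_smul,
      F.toFunctor.map_id]
    rfl
  have hev' : FdHilb.dagger (F.toFunctor.map U.ev') ≫ F.toFunctor.map U.ev' =
      ((U.dim : ℝ) : ℂ) • 𝟙 _ := by
    rw [← F.map_dagger, ← F.toFunctor.map_comp, U.dagger_ev'_comp_ev', F.toFunctor.map_smul,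
      F.toFunctor.map_id]
    rfl
  have hR : ‖R.hom (1 : ℂ)‖ ^ 2 = U.dim := by
    have h1 : ‖R.hom (1 : ℂ)‖ =
        ‖(FdHilb.dagger (F.toFunctor.map U.ev)).hom ((ε F.toFunctor).hom (1 : ℂ))‖ := by
      rw [← F.map_dagger]
      exact hδ _ _ _
    have h2 : ‖(ε F.toFunctor).hom (1 : ℂ)‖ = 1 := (hε (1 : ℂ)).trans (norm_one (α := ℂ))
    rw [h1, FdHilb.norm_sq_dagger_apply hev, h2]
    ring
  have hE : ∀ z, ‖E.hom z‖ ^ 2 ≤ U.dim * ‖z‖ ^ 2 := fun z => by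
    have h1 : ‖E.hom z‖ = ‖(F.toFunctor.map U.ev').hom ((μ F.toFunctor U U.conj).hom z)‖ :=
      hη _
    rw [h1, ← hμ]
    exact FdHilb.norm_sq_apply_le (Nat.cast_nonneg _) hev' _
  have hcomm : ‖TensorProduct.comm ℂ (F.toFunctor.obj U.conj) (F.toFunctor.obj U)
      (R.hom (1 : ℂ))‖ = ‖R.hom (1 : ℂ)‖ :=
    (TensorProduct.commIsometry ℂ (F.toFunctor.obj U.conj) (F.toFunctor.obj U)).norm_map
      (R.hom (1 : ℂ))
  have h := hE (TensorProduct.comm ℂ (F.toFunctor.obj U.conj) (F.toFunctor.obj U) (R.hom (1 : ℂ)))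
  have h7 : ‖E.hom (TensorProduct.comm ℂ (F.toFunctor.obj U.conj) (F.toFunctor.obj U)
      (R.hom (1 : ℂ)))‖ = Module.finrank ℂ (F.toFunctor.obj U) := by
    rw [← hfin]
    exact Complex.norm_natCast _
  rw [h7, hcomm, hR, ← sq] at h
  exact (pow_le_pow_iff_left₀ (by positivity) (by positivity) two_ne_zero).1 h

/-- Iterated tensor powers of a representation. -/
noncomputable def _root_.UnitaryRep.tensorPower (U : UnitaryRep G) : ℕ → UnitaryRep G
  | 0 => 𝟙_ _
  | n + 1 => U.tensorPower n ⊗ U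

theorem _root_.UnitaryRep.char_tensorPower (U : UnitaryRep G) (n : ℕ) :
    (U.tensorPower n).char = U.char ^ n := by
  induction n with
  | zero => exact UnitaryRep.char_tensorUnit.trans (pow_zero _).symm
  | succ n ih => rw [UnitaryRep.tensorPower, UnitaryRep.char_tensor, ih, pow_succ]

theorem finrank_tensorUnit : Module.finrank ℂ (F.toFunctor.obj (𝟙_ (UnitaryRep G))) = 1 := by
  let i := εIso F.toFunctor
  let e : ℂ ≃ₗ[ℂ] F.toFunctor.obj (𝟙_ (UnitaryRep G)) :=
    .ofLinearMap i.hom.hom i.inv.hom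
      (congrArg FdHilb.Hom.hom i.inv_hom_id) (congrArg FdHilb.Hom.hom i.hom_inv_id)
  rw [← e.finrank_eq, Module.finrank_self]

theorem finrank_tensorPower (U : UnitaryRep G) (n : ℕ) :
    Module.finrank ℂ (F.toFunctor.obj (U.tensorPower n)) =
      Module.finrank ℂ (F.toFunctor.obj U) ^ n := by
  induction n with
  | zero => exact F.finrank_tensorUnit
  | succ n ih => rw [UnitaryRep.tensorPower, finrank_tensorObj, ih, pow_succ]

variable [IsTopologicalGroup G] [CompactSpace G] [MeasurableSpace G] [BorelSpace G]

/-- The growth of the endomorphism spaces of the tensor powers gives a lower bound on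
dimensions. -/
theorem le_finrank_obj (U : UnitaryRep G) :
    (U.dim : ℝ) ≤ Module.finrank ℂ (F.toFunctor.obj U) := by
  -- The left side is `dim End(U^⊗n)`, which embeds in `End(F(U^⊗n))`, of dimension `dim F(U)^(2n)`.
  -- The moment principle is then evaluated at the identity, where `χ_U` equals `dim U`.
  have key : ∀ n : ℕ, ∫ x, (‖U.char x‖ ^ 2) ^ n ∂haarProb G ≤
      1 * ((Module.finrank ℂ (F.toFunctor.obj U) : ℝ) ^ 2) ^ n := by
    intro n
    have h1 := UnitaryRep.finrank_hom_eq_integral (U.tensorPower n) (U.tensorPower n)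
    have h2 : (Module.finrank ℂ (U.tensorPower n ⟶ U.tensorPower n) : ℝ) =
        ∫ x, (‖U.char x‖ ^ 2) ^ n ∂haarProb G := by
      refine Complex.ofReal_injective ?_
      rw [← integral_complex_ofReal, Complex.ofReal_natCast, h1]
      refine integral_congr_ae (.of_forall fun x => ?_)
      simp only [UnitaryRep.char_tensorPower, ContinuousMap.pow_apply]
      rw [star_pow, ← mul_pow, Complex.star_def, Complex.conj_mul']
      push_cast
      rfl
    rw [← h2, one_mul, ← pow_mul, mul_comm 2 n, pow_mul]
    have h3 := F.finrank_hom_le (U.tensorPower n)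
    rw [F.finrank_tensorPower] at h3
    exact_mod_cast h3
  have h := le_of_integral_pow_le (f := fun x => ‖U.char x‖ ^ 2) (by fun_prop)
    (fun x => by positivity) (by positivity) key 1
  simp only [UnitaryRep.char_one, Complex.norm_natCast] at h
  exact (pow_le_pow_iff_left₀ (by positivity) (by positivity) two_ne_zero).1 h

theorem finrank_obj (U : UnitaryRep G) : Module.finrank ℂ (F.toFunctor.obj U) = U.dim :=
  Nat.cast_injective (R := ℝ) (le_antisymm (F.finrank_obj_le U) (F.le_finrank_obj U))

end UnitaryFiberFunctor

theorem mainTheorem10 {G : Type u} [Group G] [TopologicalSpace G] [IsTopologicalGroup G]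
    [CompactSpace G] [T2Space G] [MeasurableSpace G] [BorelSpace G] :
    IsCoamenable.{u, w} G ∧
      ∀ (F : UnitaryFiberFunctor G) (U : UnitaryRep G),
        Module.finrank ℂ (F.toFunctor.obj U) = U.dim :=
  ⟨⟨fusionAmenable, exists_counit_extension, isEnvelopingCStarAlgebra_reducedRep⟩,
    fun F U => F.finrank_obj U⟩
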